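/- Let $n\ge 1$, $a<b$, and let $\rho_0:[a,b]\to\mathbb{R}$ be smooth and positive with $\rho_0'(a)=\rho_0'(b)=0$. Let $M_0\subset\mathbb{R}^{n+1}$ be the $n$-dimensional hypersurface generated by rotating the graph of $\rho_0$ about the $x_1$-axis. Consider axially symmetric volume preserving mean curvature flow starting from $M_0$: for $0\le t<T$ the hypersurface $M_t=\mathbf{x}(M_0,t)$ is generated by rotating about the $x_1$-axis the graph of a positive function $\rho(\cdot,t):[a,b]\to\mathbb{R}$ with $\partial_{x_1}\rho(a,t)=\partial_{x_1}\rho(b,t)=0$ and $\rho(\cdot,0)=\rho_0$; the function $\rho$ is smooth on $[a,b]\times(0,T)$, and $\rho$ and $\partial_{x_1}\rho$ are continuous on $[a,b]\times[0,T)$; for every $l\in M_0$ the path $t\mapsto\mathbf{x}(l,t)$ is continuous on $[0,T)$, $\mathbf{x}(l,0)=l$, and $$\frac{d}{dt}\mathbf{x}(l,t)=-\bigl(H(l,t)-h(t)\bigr)\,\nu(l,t)\quad(0<t<T),\qquad h(t)=\frac{\int_{M_t}H\,dg_t}{\int_{M_t}dg_t}.$$ Here $\nu$ is the outer unit normal of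 $M_t$ (pointing away from the axis), $H$ is the mean curvature (the trace of the shape operator $\tau\mapsto\overline\nabla_\tau\nu$), and $g_t$ is the induced metric. Put $\mathbf{i}_1=(1,0,\dots,0)$, $\hat{\mathbf{x}}=\mathbf{x}-\langle\mathbf{x},\mathbf{i}_1\rangle\mathbf{i}_1$, $\omega=\hat{\mathbf{x}}/|\hat{\mathbf{x}}|$, and let $$y=\langle\mathbf{x},\omega\rangle,\qquad v=\langle\omega,\nu\rangle^{-1}$$ be the height function and the gradient function. Then there is a constant $c_4$, depending only on $M_0$, with the following property: for every such flow that develops its first singularity at a time $T\in(0,\infty)$, that is, which cannot be continued as such a solution beyond $T$, one has $$v\,y<c_4\quad\text{on } M_t\text{ for all } t\in[0,T).$$ -/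

import Mathlib

open Set MeasureTheory
open scoped ContDiff

noncomputable section

namespace AxialFlow

/-! ### Points of `ℝ^{n+1}` relative to the `x₁`-axis (the coordinate with index `0`) -/

/-- The ambient space `ℝ^{n+1}`. -/
abbrev Amb (n : ℕ) : Type := EuclideanSpace ℝ (Fin (n + 1))

/-- The unit vector `i₁` spanning the axis of rotation. -/
def axis (n : ℕ) : Amb n := EuclideanSpace.single 0 1

/-- `x̂ = x - ⟨x, i₁⟩ i₁`. -/
def hat {n : ℕ} (x : Amb n) : Amb n := x - inner ℝ x (axis n) • axis n

/-- `ω = x̂ / |x̂|`, the outward unit normal of the cylinder about the axis through `x`. -/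
def omega {n : ℕ} (x : Amb n) : Amb n := ‖hat x‖⁻¹ • hat x

/-- The height function `y = ⟨x, ω⟩`. -/
def height {n : ℕ} (x : Amb n) : ℝ := inner ℝ x (omega x)

/-- The closed region between the planes `x₁ = a` and `x₁ = b`. -/
def slab (n : ℕ) (a b : ℝ) : Set (Amb n) := {x | x 0 ∈ Icc a b}

/-! ### The hypersurface generated by rotating the graph of `r : [a, b] → ℝ` -/

/-- The hypersurface generated by rotating the graph of `r : [a, b] → ℝ` about the axis. -/
def revolution (n : ℕ) (a b : ℝ) (r : ℝ → ℝ) : Set (Amb n) :=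
  {x | x ∈ slab n a b ∧ ‖hat x‖ = r (x 0)}

/-- A function that vanishes exactly on the hypersurface and is positive outside it. -/
def levelFun {n : ℕ} (r : ℝ → ℝ) (x : Amb n) : ℝ := ‖hat x‖ - r (x 0)

/-- The outer unit normal `ν` of the hypersurface, as the normalized gradient of the defining
function (all derivatives are one-sided, from within the slab, at the two planes). It is also
defined off the hypersurface; only its restriction to the hypersurface and its derivatives in
tangential directions are used. -/
def normal {n : ℕ} (a b : ℝ) (r : ℝ → ℝ) (x : Amb n) : Amb n :=
  ‖gradientWithin (levelFun r) (slab n a b) x‖⁻¹ • gradientWithin (levelFun r) (slab n a b) x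

/-- The tangent space of the hypersurface at `x`. -/
abbrev tangent {n : ℕ} (a b : ℝ) (r : ℝ → ℝ) (x : Amb n) : Submodule ℝ (Amb n) :=
  (Submodule.span ℝ {normal a b r x})ᗮ

/-- The shape operator `τ ↦ ∇_τ ν` on the tangent space at `x`. -/
def shape {n : ℕ} (a b : ℝ) (r : ℝ → ℝ) (x : Amb n) :
    tangent a b r x →ₗ[ℝ] tangent a b r x :=
  ((tangent a b r x).orthogonalProjectionOnto ∘L
    fderivWithin ℝ (normal a b r) (slab n a b) x ∘L (tangent a b r x).subtypeL).toLinearMap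

/-- The mean curvature `H` with respect to `ν`: the trace of the shape operator. -/
def meanCurv {n : ℕ} (a b : ℝ) (r : ℝ → ℝ) (x : Amb n) : ℝ :=
  LinearMap.trace ℝ _ (shape a b r x)

/-- The gradient function `v = ⟨ω, ν⟩⁻¹`. -/
def gradFun {n : ℕ} (a b : ℝ) (r : ℝ → ℝ) (x : Amb n) : ℝ :=
  (inner ℝ (omega x) (normal a b r x))⁻¹

/-! ### Integration with respect to the induced metric -/

/-- The inclusion of `ℝ^n` in `ℝ^{n+1}` as the hyperplane orthogonal to the axis. -/
def incl (n : ℕ) : EuclideanSpace ℝ (Fin n) →ₗ[ℝ] Amb n where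
  toFun θ := WithLp.toLp 2 (Fin.cons 0 θ)
  map_add' θ η := by
    ext i; refine Fin.cases ?_ (fun j => ?_) i <;> simp
  map_smul' c θ := by
    ext i; refine Fin.cases ?_ (fun j => ?_) i <;> simp

/-- The parametrization `(s, θ) ↦ s i₁ + r(s) θ` of the hypersurface, with `s ∈ [a, b]` and
`θ ∈ S^{n-1} ⊆ ℝ^n`. -/
def param (n : ℕ) (r : ℝ → ℝ) (q : ℝ × EuclideanSpace ℝ (Fin n)) : Amb n :=
  q.1 • axis n + r q.1 • incl n q.2

/-- The differential of the parametrization on the tangent space `ℝ × θ^⊥` of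
`[a, b] × S^{n-1}` at `(s, θ)`. -/
def paramDiff (n : ℕ) (a b : ℝ) (r : ℝ → ℝ) (s : ℝ) (θ : EuclideanSpace ℝ (Fin n)) :
    WithLp 2 (ℝ × (Submodule.span ℝ {θ})ᗮ) →ₗ[ℝ] Amb n :=
  (fderivWithin ℝ (param n r) (Icc a b ×ˢ univ) (s, θ)).toLinearMap ∘ₗ
    LinearMap.prodMap LinearMap.id ((Submodule.span ℝ {θ})ᗮ).subtype ∘ₗ
    (WithLp.linearEquiv 2 ℝ (ℝ × (Submodule.span ℝ {θ})ᗮ)).toLinearMap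

/-- The area density `√(det g)` of the induced metric `g` relative to the product metric on
`[a, b] × S^{n-1}`. -/
def areaDensity (n : ℕ) (a b : ℝ) (r : ℝ → ℝ) (s : ℝ) (θ : EuclideanSpace ℝ (Fin n)) : ℝ :=
  √(LinearMap.det ((paramDiff n a b r s θ).adjoint ∘ₗ paramDiff n a b r s θ))

/-- The integral of `f` over the hypersurface with respect to the induced metric. -/
def surfIntegral (n : ℕ) (a b : ℝ) (r : ℝ → ℝ) (f : Amb n → ℝ) : ℝ :=
  ∫ s in Icc a b, ∫ θ : Metric.sphere (0 : EuclideanSpace ℝ (Fin n)) 1,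
    f (param n r (s, (θ : EuclideanSpace ℝ (Fin n)))) * areaDensity n a b r s θ
      ∂(volume : Measure (EuclideanSpace ℝ (Fin n))).toSphere

/-- The average `h = ∫ H dg / ∫ dg` of the mean curvature. -/
def avgMeanCurv (n : ℕ) (a b : ℝ) (r : ℝ → ℝ) : ℝ :=
  surfIntegral n a b r (meanCurv a b r) / surfIntegral n a b r (fun _ => 1)

/-! ### The flow -/

/-- An initial radius function: smooth and positive on `[a, b]`, with vanishing derivative at the
end points. -/
structure IsInitialRadius (a b : ℝ) (ρ₀ : ℝ → ℝ) : Prop where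
  smooth : ContDiffOn ℝ ∞ ρ₀ (Icc a b)
  pos : ∀ s ∈ Icc a b, 0 < ρ₀ s
  neumann_left : derivWithin ρ₀ (Icc a b) a = 0
  neumann_right : derivWithin ρ₀ (Icc a b) b = 0

/-- A solution on `[0, T)` of the axially symmetric volume preserving mean curvature flow between
the planes `x₁ = a` and `x₁ = b`, with Neumann boundary conditions, starting from the
hypersurface `M₀` generated by `ρ₀`. The hypersurface `M_t` is generated by `radius t`, and the
position vector `pos t : M₀ → ℝ^{n+1}` parametrizes it. The solution is smooth, up to the
boundary, for `0 < t < T`, and attains its initial value in `C¹` (smoothness up to `t = 0` is not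
asked for, since it would impose higher order compatibility conditions on `ρ₀`). -/
structure Flow (n : ℕ) (a b : ℝ) (ρ₀ : ℝ → ℝ) (T : ℝ) where
  /-- the radius function; `radius t s` is the radius at time `t` over the axial coordinate `s` -/
  radius : ℝ → ℝ → ℝ
  /-- the position vector; `pos t l` is the position at time `t` of the particle `l ∈ M₀` -/
  pos : ℝ → Amb n → Amb n
  radius_pos : ∀ t ∈ Ico 0 T, ∀ s ∈ Icc a b, 0 < radius t s
  radius_smooth : ContDiffOn ℝ ∞ (fun q : ℝ × ℝ => radius q.1 q.2) (Ioo 0 T ×ˢ Icc a b)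
  radius_cont : ContinuousOn (fun q : ℝ × ℝ => radius q.1 q.2) (Ico 0 T ×ˢ Icc a b)
  radius_deriv_cont :
    ContinuousOn (fun q : ℝ × ℝ => derivWithin (radius q.1) (Icc a b) q.2) (Ico 0 T ×ˢ Icc a b)
  radius_zero : ∀ s ∈ Icc a b, radius 0 s = ρ₀ s
  neumann_left : ∀ t ∈ Ico 0 T, derivWithin (radius t) (Icc a b) a = 0
  neumann_right : ∀ t ∈ Ico 0 T, derivWithin (radius t) (Icc a b) b = 0
  pos_zero : ∀ l ∈ revolution n a b ρ₀, pos 0 l = l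
  pos_cont : ∀ l ∈ revolution n a b ρ₀, ContinuousOn (fun t => pos t l) (Ico 0 T)
  pos_image : ∀ t ∈ Ico 0 T, pos t '' revolution n a b ρ₀ = revolution n a b (radius t)
  /-- the flow equation `dx/dt = -(H - h) ν` -/
  evolution : ∀ l ∈ revolution n a b ρ₀, ∀ t ∈ Ioo 0 T,
    HasDerivAt (fun τ => pos τ l)
      (-(meanCurv a b (radius t) (pos t l) - avgMeanCurv n a b (radius t)) •
        normal a b (radius t) (pos t l)) t

/-- The evolving hypersurface `M_t`. -/
def Flow.surface {n : ℕ} {a b : ℝ} {ρ₀ : ℝ → ℝ} {T : ℝ} (F : Flow n a b ρ₀ T) (t : ℝ) :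
    Set (Amb n) :=
  revolution n a b (F.radius t)

/-- The flow becomes singular at the time `T`: it cannot be continued, as a (smooth) solution,
beyond `T`. -/
def Flow.IsSingularAtEnd {n : ℕ} {a b : ℝ} {ρ₀ : ℝ → ℝ} {T : ℝ} (F : Flow n a b ρ₀ T) : Prop :=
  ¬ ∃ T' > T, ∃ F' : Flow n a b ρ₀ T', ∀ t ∈ Ico 0 T, F'.surface t = F.surface t

end AxialFlow

end

/-! In terms of the radius `ρ` and its slope `q = ∂ₛρ` the quantity `v y` is `ρ √(1 + q²)`, and the
flow is the scalar equation `∂ₜρ = ∂ₛq / (1 + q²) - (n - 1) / ρ + h √(1 + q²)` with Neumann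
conditions. At a spatial maximum of `v y` the first and second order conditions give `∂ₜ(v y) ≤ h`
(`gradient_height_evolution_le`): the `h` terms combine to exactly `h`, and the rest has a sign.

It remains to bound the time integral of `h`; no pointwise bound is needed. Volume is preserved and
area does not increase, so `ρ` is bounded (`pow_le`). Testing the equation with `ρⁿ` shows that `∫
ρⁿ⁺¹ / (n + 1)` grows at least at the rate `V h - 3 n A`, with `V = ∫ ρ₀ⁿ` and `A` the initial area
up to the measure of the unit sphere. Hence `h` is at most the derivative of a function `G` that is
bounded on a finite time interval (`exists_barrier`), and the maximum principle applied to `v y - G`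
bounds `v y` (`exists_gradient_height_bound`).

This bound involves `T`. It depends on `M₀` alone because flows with the same initial radius
coincide while both exist, so all singular flows share one singular time (`singular_time_le`).
Uniqueness is an L² energy estimate: the principal part is `∂ₛ arctan q`, `arctan` is strongly
monotone on bounded sets, and `h`, once integrated by parts, is Lipschitz in `ρ` and `q`. -/

namespace AxialFlow

/-! ### Normal, gradient function and mean curvature of a surface of revolution. -/

section Geometry

variable {n : ℕ}

lemma inner_axis (x : Amb n) : inner ℝ x (axis n) = x 0 := by
  simp [axis, EuclideanSpace.inner_single_right]

lemma inner_axis_left (x : Amb n) : inner ℝ (axis n) x = x 0 := by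
  rw [real_inner_comm, inner_axis]

@[simp] lemma axis_zero : axis n 0 = 1 := by simp [axis]

lemma norm_axis : ‖axis n‖ = 1 := by simp [axis]

lemma hat_eq (x : Amb n) : hat x = x - x 0 • axis n := by rw [hat, inner_axis]

@[simp] lemma hat_zero (x : Amb n) : hat x 0 = 0 := by simp [hat_eq]

/-- The orthogonal projection `x ↦ x̂` as a continuous linear map. -/
noncomputable def hatL (n : ℕ) : Amb n →L[ℝ] Amb n :=
  ContinuousLinearMap.id ℝ (Amb n) - (EuclideanSpace.proj 0 : Amb n →L[ℝ] ℝ).smulRight (axis n)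

lemma hatL_apply (x : Amb n) : hatL n x = hat x := by
  simp [hatL, hat_eq]

@[simp] lemma omega_zero (x : Amb n) : omega x 0 = 0 := by simp [omega]

lemma norm_omega {x : Amb n} (hx : hat x ≠ 0) : ‖omega x‖ = 1 := by
  rw [omega, norm_smul, norm_inv, norm_norm, inv_mul_cancel₀ (norm_ne_zero_iff.2 hx)]

lemma inner_omega_hat (x y : Amb n) : inner ℝ (omega x) (hat y) = inner ℝ (omega x) y := by
  rw [hat_eq, inner_sub_right, inner_smul_right, inner_axis, omega_zero, mul_zero, sub_zero]

lemma inner_hat_self (x : Amb n) : inner ℝ x (hat x) = ‖hat x‖ ^ 2 := by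
  have h : inner ℝ (hat x) (hat x) = inner ℝ x (hat x) := by
    conv_lhs => enter [2]; rw [hat_eq]
    rw [inner_sub_left, inner_smul_left, inner_axis_left, hat_zero]
    simp
  rw [← h, real_inner_self_eq_norm_sq]

lemma height_eq (x : Amb n) : height x = ‖hat x‖ := by
  rw [height, omega, inner_smul_right, inner_hat_self]
  by_cases h : ‖hat x‖ = 0
  · simp [h]
  · field_simp

lemma hasFDerivAt_hat (x : Amb n) : HasFDerivAt (fun y : Amb n => hat y) (hatL n) x :=
  ((hatL n).hasFDerivAt (x := x)).congr_of_eventuallyEq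
    (Filter.Eventually.of_forall fun y => (hatL_apply y).symm)

lemma hasFDerivAt_norm_hat {x : Amb n} (hx : hat x ≠ 0) :
    HasFDerivAt (fun y : Amb n => ‖hat y‖) (innerSL ℝ (omega x)) x := by
  have h1 := hasFDerivAt_hat x
  have h3 := (h1.norm_sq).sqrt (by simpa using hx)
  have h4 : (fun y : Amb n => √(‖hat y‖ ^ 2)) = fun y => ‖hat y‖ := by
    ext y; exact Real.sqrt_sq (norm_nonneg _)
  rw [h4] at h3
  refine h3.congr_fderiv ?_
  ext τ
  have h0 : ‖hat x‖ ≠ 0 := norm_ne_zero_iff.2 hx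
  rw [innerSL_apply_apply, ← inner_omega_hat, omega, inner_smul_left]
  simp [Real.sqrt_sq (norm_nonneg _), hatL_apply]
  field_simp

/-- The derivative of `ω` at `x`. -/
noncomputable def omegaDeriv (x : Amb n) : Amb n →L[ℝ] Amb n :=
  ‖hat x‖⁻¹ • (hatL n - (innerSL ℝ (omega x)).smulRight (omega x))

lemma hasFDerivAt_omega {x : Amb n} (hx : hat x ≠ 0) :
    HasFDerivAt (fun y : Amb n => omega y) (omegaDeriv x) x := by
  have h1 := hasFDerivAt_hat x
  have h0 : ‖hat x‖ ≠ 0 := norm_ne_zero_iff.2 hx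
  have h2 := (hasDerivAt_inv h0).comp_hasFDerivAt x (hasFDerivAt_norm_hat hx)
  have h3 := h2.smul h1
  refine h3.congr_fderiv ?_
  ext1 τ
  simp only [omegaDeriv, add_apply, smul_apply,
    sub_apply, ContinuousLinearMap.smulRight_apply, smul_sub, hatL_apply,
    innerSL_apply_apply, neg_smul]
  rw [sub_eq_add_neg]
  congr 1
  rw [omega, inner_smul_left]
  simp only [smul_smul, ← neg_smul]
  congr 1
  simp
  field_simp

lemma convex_slab (a b : ℝ) : Convex ℝ (slab n a b) :=
  (convex_Icc a b).linear_preimage (EuclideanSpace.proj 0 : Amb n →L[ℝ] ℝ).toLinearMap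

/-- A convex set with interior points has unique derivatives, so the one-sided derivatives on the
two bounding planes are determined by any derivative that is exhibited. -/
lemma uniqueDiffOn_slab {a b : ℝ} (hab : a < b) : UniqueDiffOn ℝ (slab n a b) := by
  refine uniqueDiffOn_convex (convex_slab a b) ?_
  have hc : Continuous fun x : Amb n => x 0 := (EuclideanSpace.proj 0 : Amb n →L[ℝ] ℝ).continuous
  have ho : IsOpen {x : Amb n | x 0 ∈ Ioo a b} := isOpen_Ioo.preimage hc
  refine ⟨((a + b) / 2) • axis n, ?_⟩
  have hs : {x : Amb n | x 0 ∈ Ioo a b} ⊆ slab n a b := fun x hx => ⟨hx.1.le, hx.2.le⟩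
  refine interior_maximal hs ho ?_
  simp only [mem_ofPred_eq, PiLp.smul_apply, axis_zero, smul_eq_mul, mul_one, mem_Ioo]
  constructor <;> linarith

lemma hasFDerivWithinAt_comp_zero {a b : ℝ} {f : ℝ → ℝ} {f' : ℝ} {x : Amb n}
    (hf : HasDerivWithinAt f f' (Icc a b) (x 0)) :
    HasFDerivWithinAt (fun y : Amb n => f (y 0)) (f' • (EuclideanSpace.proj 0 : Amb n →L[ℝ] ℝ))
      (slab n a b) x := by
  have h1 : HasFDerivWithinAt (fun y : Amb n => y 0) (EuclideanSpace.proj 0 : Amb n →L[ℝ] ℝ)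
      (slab n a b) x := (EuclideanSpace.proj 0 : Amb n →L[ℝ] ℝ).hasFDerivWithinAt
  have h2 := hf.hasFDerivWithinAt.comp x h1 (t := Icc a b) (fun y hy => hy)
  refine h2.congr_fderiv ?_
  ext τ
  simp [mul_comm]

lemma gradientWithin_levelFun {a b : ℝ} (hab : a < b) {r : ℝ → ℝ} {r' : ℝ} {x : Amb n}
    (hxs : x ∈ slab n a b) (hx : hat x ≠ 0) (hr : HasDerivWithinAt r r' (Icc a b) (x 0)) :
    gradientWithin (levelFun r) (slab n a b) x = omega x - r' • axis n := by
  have h : HasGradientWithinAt (levelFun r) (omega x - r' • axis n) (slab n a b) x := by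
    rw [hasGradientWithinAt_iff_hasFDerivWithinAt]
    refine ((hasFDerivAt_norm_hat hx).hasFDerivWithinAt.sub
      (hasFDerivWithinAt_comp_zero hr)).congr_fderiv ?_
    ext τ
    simp [inner_axis_left]
  rw [gradientWithin, h.hasFDerivWithinAt.fderivWithin (uniqueDiffOn_slab hab x hxs)]
  simp

/-- `ω` and `i₁` are orthonormal. For `c` the slope, `ω - c i₁` is the unnormalized normal. -/
lemma inner_conormal {x : Amb n} (hx : hat x ≠ 0) (c d : ℝ) :
    inner ℝ (omega x - c • axis n) (omega x - d • axis n) = 1 + c * d := by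
  simp only [inner_sub_left, inner_sub_right, inner_smul_left, inner_smul_right, inner_axis,
    inner_axis_left, omega_zero, real_inner_self_eq_norm_sq, norm_omega hx, norm_axis]
  simp [mul_comm]

lemma norm_conormal {x : Amb n} (hx : hat x ≠ 0) (c : ℝ) :
    ‖omega x - c • axis n‖ = √(1 + c ^ 2) := by
  rw [norm_eq_sqrt_real_inner, inner_conormal hx, sq]

lemma normal_eq {a b : ℝ} (hab : a < b) {r : ℝ → ℝ} {r' : ℝ} {x : Amb n}
    (hxs : x ∈ slab n a b) (hx : hat x ≠ 0) (hr : HasDerivWithinAt r r' (Icc a b) (x 0)) :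
    normal a b r x = (√(1 + r' ^ 2))⁻¹ • (omega x - r' • axis n) := by
  rw [normal, gradientWithin_levelFun hab hxs hx hr, norm_conormal hx]

lemma gradFun_eq {a b : ℝ} (hab : a < b) {r : ℝ → ℝ} {r' : ℝ} {x : Amb n}
    (hxs : x ∈ slab n a b) (hx : hat x ≠ 0) (hr : HasDerivWithinAt r r' (Icc a b) (x 0)) :
    gradFun a b r x = √(1 + r' ^ 2) := by
  rw [gradFun, normal_eq hab hxs hx hr, inner_smul_right]
  have := inner_conormal hx 0 r'
  rw [zero_smul, sub_zero] at this
  rw [this]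
  simp

/-- The derivative of the normal along the slab, in terms of the first two derivatives of the
radius function. -/
noncomputable def normalDeriv (x : Amb n) (q p : ℝ) : Amb n →L[ℝ] Amb n :=
  (√(1 + q ^ 2))⁻¹ • omegaDeriv x +
    (EuclideanSpace.proj 0 : Amb n →L[ℝ] ℝ).smulRight
      (-(p / √(1 + q ^ 2)) • axis n - (q * p / √(1 + q ^ 2) ^ 3) • (omega x - q • axis n))

lemma hasFDerivWithinAt_normal {a b : ℝ} (hab : a < b) {r q : ℝ → ℝ} {p : ℝ} {x : Amb n}
    (hxs : x ∈ slab n a b) (hx : hat x ≠ 0)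
    (hr : ∀ s ∈ Icc a b, HasDerivWithinAt r (q s) (Icc a b) s)
    (hq : HasDerivWithinAt q p (Icc a b) (x 0)) :
    HasFDerivWithinAt (normal a b r) (normalDeriv x (q (x 0)) p) (slab n a b) x := by
  have hpos : 0 < 1 + q (x 0) ^ 2 := by positivity
  have hv : √(1 + q (x 0) ^ 2) ≠ 0 := (Real.sqrt_pos.2 hpos).ne'
  have h1 : HasDerivWithinAt (fun s => (√(1 + q s ^ 2))⁻¹)
      (-(q (x 0) * p / √(1 + q (x 0) ^ 2) ^ 3)) (Icc a b) (x 0) := by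
    have h := (((hq.pow 2).const_add 1).sqrt hpos.ne').inv hv
    refine h.congr_deriv ?_
    simp
    field_simp
  have h2 := (hasFDerivWithinAt_comp_zero h1).smul
    ((hasFDerivAt_omega hx).hasFDerivWithinAt.sub
      ((hasFDerivWithinAt_comp_zero hq).smul_const (axis n)))
  -- The formula for the normal also holds off the surface, on a full neighbourhood within the slab,
  -- so it may be differentiated in every direction.
  have hev : normal a b r =ᶠ[nhdsWithin x (slab n a b)]
      fun y => (√(1 + q (y 0) ^ 2))⁻¹ • (omega y - q (y 0) • axis n) := by
    have hc : ContinuousAt (fun y : Amb n => ‖hat y‖) x := (hasFDerivAt_norm_hat hx).continuousAt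
    filter_upwards [self_mem_nhdsWithin,
      nhdsWithin_le_nhds (hc.eventually_ne (norm_ne_zero_iff.2 hx))] with y hys hy
    exact normal_eq hab hys (norm_ne_zero_iff.1 hy) (hr _ hys)
  refine (h2.congr_of_eventuallyEq hev (normal_eq hab hxs hx (hr _ hxs))).congr_fderiv ?_
  ext1 τ
  simp only [normalDeriv, add_apply, smul_apply,
    sub_apply, ContinuousLinearMap.smulRight_apply, smul_sub, smul_eq_mul,
    smul_smul, PiLp.proj_apply, Pi.sub_apply]
  module

lemma trace_hatL : LinearMap.trace ℝ (Amb n) (hatL n).toLinearMap = n := by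
  have : (hatL n).toLinearMap = LinearMap.id -
      (EuclideanSpace.proj 0 : Amb n →L[ℝ] ℝ).toLinearMap.smulRight (axis n) := by
    ext; simp [hatL]
  rw [this, map_sub, LinearMap.trace_id, LinearMap.trace_smulRight]
  simp

lemma trace_normalDeriv {x : Amb n} (hx : hat x ≠ 0) (q p : ℝ) :
    LinearMap.trace ℝ (Amb n) (normalDeriv x q p).toLinearMap =
      (n - 1) / (‖hat x‖ * √(1 + q ^ 2)) - p / √(1 + q ^ 2) ^ 3 := by
  have : (normalDeriv x q p).toLinearMap =
      ((√(1 + q ^ 2))⁻¹ * ‖hat x‖⁻¹) • ((hatL n).toLinearMap -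
        (innerSL ℝ (omega x)).toLinearMap.smulRight (omega x)) +
      (EuclideanSpace.proj 0 : Amb n →L[ℝ] ℝ).toLinearMap.smulRight
      (-(p / √(1 + q ^ 2)) • axis n - (q * p / √(1 + q ^ 2) ^ 3) • (omega x - q • axis n)) := by
    ext1 τ
    simp [normalDeriv, omegaDeriv, smul_smul]
  rw [this, map_add, map_smul, map_sub, trace_hatL, LinearMap.trace_smulRight,
    LinearMap.trace_smulRight]
  have hpos : 0 < 1 + q ^ 2 := by positivity
  have hv : √(1 + q ^ 2) ≠ 0 := (Real.sqrt_pos.2 hpos).ne'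
  have hv2 : √(1 + q ^ 2) ^ 2 = 1 + q ^ 2 := Real.sq_sqrt hpos.le
  have h0 : ‖hat x‖ ≠ 0 := norm_ne_zero_iff.2 hx
  simp [norm_omega hx]
  field_simp
  rw [hv2]
  ring

/-- The extended normal field has unit length, so its derivative is orthogonal to it. Consequently
restricting to the tangent space does not change the trace. -/
lemma inner_normalDeriv {x : Amb n} (hx : hat x ≠ 0) (q p : ℝ) :
    inner ℝ (omega x - q • axis n) (normalDeriv x q p (omega x - q • axis n)) = 0 := by
  have hpos : 0 < 1 + q ^ 2 := by positivity
  have hv : √(1 + q ^ 2) ≠ 0 := (Real.sqrt_pos.2 hpos).ne'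
  have hv2 : √(1 + q ^ 2) ^ 2 = 1 + q ^ 2 := Real.sq_sqrt hpos.le
  have ho : inner ℝ (omega x) (omega x - q • axis n) = 1 := by
    simpa using inner_conormal hx 0 q
  have hh : hat (omega x - q • axis n) = omega x := by
    rw [hat_eq]; simp
  have h0 : omegaDeriv x (omega x - q • axis n) = 0 := by
    simp [omegaDeriv, hatL_apply, hh, ho]
  have h1 : inner ℝ (omega x - q • axis n) (axis n) = -q := by
    simp [inner_axis]
  rw [normalDeriv, add_apply, smul_apply, h0, smul_zero,
    zero_add, ContinuousLinearMap.smulRight_apply, inner_smul_right, inner_sub_right,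
    inner_smul_right, inner_smul_right, inner_conormal hx, h1]
  field_simp
  rw [hv2]
  ring

/-- By cyclicity, the trace of `P L ι` is that of `L ι P`, and `ι P` subtracts the component along
`ν`. This yields `H` from an ambient trace, without a basis of the tangent space. -/
lemma trace_compression (L : Amb n →L[ℝ] Amb n) {ν : Amb n} (hν : ‖ν‖ = 1) :
    LinearMap.trace ℝ _ ((Submodule.span ℝ {ν})ᗮ.orthogonalProjectionOnto ∘L L ∘L
        ((Submodule.span ℝ {ν})ᗮ).subtypeL).toLinearMap =
      LinearMap.trace ℝ (Amb n) L.toLinearMap - inner ℝ ν (L ν) := by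
  have h1 : ((Submodule.span ℝ {ν})ᗮ.orthogonalProjectionOnto ∘L L ∘L
        ((Submodule.span ℝ {ν})ᗮ).subtypeL).toLinearMap =
      ((Submodule.span ℝ {ν})ᗮ.orthogonalProjectionOnto).toLinearMap ∘ₗ
        (L.toLinearMap ∘ₗ ((Submodule.span ℝ {ν})ᗮ).subtype) := rfl
  rw [h1, LinearMap.trace_comp_comm']
  have h2 : (L.toLinearMap ∘ₗ ((Submodule.span ℝ {ν})ᗮ).subtype) ∘ₗ
      ((Submodule.span ℝ {ν})ᗮ.orthogonalProjectionOnto).toLinearMap =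
      L.toLinearMap - (innerSL ℝ ν).toLinearMap.smulRight (L ν) := by
    ext1 τ
    have : (((Submodule.span ℝ {ν})ᗮ.orthogonalProjectionOnto τ : (Submodule.span ℝ {ν})ᗮ) : Amb n)
        = τ - inner ℝ ν τ • ν := by
      rw [← Submodule.starProjection_apply, Submodule.starProjection_orthogonal_val,
        Submodule.starProjection_unit_singleton ℝ hν]
    simp [this]
  rw [h2, map_sub, LinearMap.trace_smulRight]
  simp

/-- The mean curvature of the hypersurface generated by rotating the graph of `r`. -/
lemma meanCurv_eq {a b : ℝ} (hab : a < b) {r q : ℝ → ℝ} {p : ℝ} {x : Amb n}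
    (hxs : x ∈ slab n a b) (hx : hat x ≠ 0)
    (hr : ∀ s ∈ Icc a b, HasDerivWithinAt r (q s) (Icc a b) s)
    (hq : HasDerivWithinAt q p (Icc a b) (x 0)) :
    meanCurv a b r x =
      (n - 1) / (‖hat x‖ * √(1 + q (x 0) ^ 2)) - p / √(1 + q (x 0) ^ 2) ^ 3 := by
  have hν : normal a b r x = _ := normal_eq hab hxs hx (hr _ hxs)
  have hpos : 0 < √(1 + q (x 0) ^ 2) := Real.sqrt_pos.2 (by positivity)
  have hn1 : ‖normal a b r x‖ = 1 := by
    rw [hν, norm_smul, norm_conormal hx, norm_inv, Real.norm_of_nonneg hpos.le,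
      inv_mul_cancel₀ hpos.ne']
  rw [meanCurv, shape, trace_compression _ hn1,
    (hasFDerivWithinAt_normal hab hxs hx hr hq).fderivWithin (uniqueDiffOn_slab hab x hxs),
    trace_normalDeriv hx, hν, map_smul, inner_smul_left, inner_smul_right, inner_normalDeriv hx]
  simp

end Geometry

/-! ### Area element and average mean curvature as one-dimensional integrals. -/

section Area

variable {n : ℕ}

lemma incl_zero (θ : EuclideanSpace ℝ (Fin n)) : incl n θ 0 = 0 := rfl

lemma inner_incl (θ η : EuclideanSpace ℝ (Fin n)) :
    inner ℝ (incl n θ) (incl n η) = inner ℝ θ η := by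
  simp [PiLp.inner_apply, Fin.sum_univ_succ, incl]

lemma norm_incl (θ : EuclideanSpace ℝ (Fin n)) : ‖incl n θ‖ = ‖θ‖ := by
  rw [norm_eq_sqrt_real_inner, inner_incl, ← norm_eq_sqrt_real_inner]

lemma param_zero (r : ℝ → ℝ) (q : ℝ × EuclideanSpace ℝ (Fin n)) : param n r q 0 = q.1 := by
  simp [param, incl_zero]

lemma hat_param (r : ℝ → ℝ) (q : ℝ × EuclideanSpace ℝ (Fin n)) :
    hat (param n r q) = r q.1 • incl n q.2 := by
  rw [hat_eq, param_zero, param]; simp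

lemma norm_hat_param {r : ℝ → ℝ} {q : ℝ × EuclideanSpace ℝ (Fin n)} (hq : ‖q.2‖ = 1)
    (hr : 0 ≤ r q.1) : ‖hat (param n r q)‖ = r q.1 := by
  rw [hat_param, norm_smul, norm_incl, hq, mul_one, Real.norm_of_nonneg hr]

lemma fderivWithin_param {a b : ℝ} (hab : a < b) {r : ℝ → ℝ} {r' s : ℝ}
    (hs : s ∈ Icc a b) (hr : HasDerivWithinAt r r' (Icc a b) s)
    (θ : EuclideanSpace ℝ (Fin n)) (w : ℝ × EuclideanSpace ℝ (Fin n)) :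
    fderivWithin ℝ (param n r) (Icc a b ×ˢ univ) (s, θ) w =
      w.1 • axis n + (w.1 * r') • incl n θ + r s • incl n w.2 := by
  have hu : UniqueDiffWithinAt ℝ (Icc a b ×ˢ (univ : Set (EuclideanSpace ℝ (Fin n)))) (s, θ) :=
    ((uniqueDiffOn_Icc hab).prod uniqueDiffOn_univ) _ ⟨hs, mem_univ _⟩
  have h1 : HasFDerivWithinAt (fun q : ℝ × EuclideanSpace ℝ (Fin n) => q.1)
      (ContinuousLinearMap.fst ℝ ℝ (EuclideanSpace ℝ (Fin n))) (Icc a b ×ˢ univ) (s, θ) :=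
    hasFDerivWithinAt_fst
  have h2 : HasFDerivWithinAt (fun q : ℝ × EuclideanSpace ℝ (Fin n) => incl n q.2)
      ((LinearMap.toContinuousLinearMap (incl n)).comp
        (ContinuousLinearMap.snd ℝ ℝ (EuclideanSpace ℝ (Fin n)))) (Icc a b ×ˢ univ) (s, θ) :=
    ((LinearMap.toContinuousLinearMap (incl n)).comp
        (ContinuousLinearMap.snd ℝ ℝ (EuclideanSpace ℝ (Fin n)))).hasFDerivWithinAt
  have h3 : HasFDerivWithinAt (fun q : ℝ × EuclideanSpace ℝ (Fin n) => r q.1) _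
      (Icc a b ×ˢ univ) (s, θ) :=
    hr.hasFDerivWithinAt.comp (s, θ) h1 (t := Icc a b) (fun q hq => hq.1)
  have h4 := (h1.smul_const (axis n)).add (h3.smul h2)
  have h5 : fderivWithin ℝ (param n r) (Icc a b ×ˢ univ) (s, θ) = _ := h4.fderivWithin hu
  rw [h5]
  simp
  module

/-- The cross terms vanish because `θ` is orthogonal to the tangent space of the sphere; the pulled
back metric is block diagonal. -/
lemma inner_paramDiff {a b : ℝ} (hab : a < b) {r : ℝ → ℝ} {r' s : ℝ}
    (hs : s ∈ Icc a b) (hr : HasDerivWithinAt r r' (Icc a b) s)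
    {θ : EuclideanSpace ℝ (Fin n)} (hθ : ‖θ‖ = 1)
    (u w : WithLp 2 (ℝ × (Submodule.span ℝ {θ})ᗮ)) :
    inner ℝ (paramDiff n a b r s θ u) (paramDiff n a b r s θ w) =
      inner ℝ (((1 + r' ^ 2) * u.fst)) w.fst + inner ℝ ((r s ^ 2) • u.snd) w.snd := by
  have e : ∀ u : WithLp 2 (ℝ × (Submodule.span ℝ {θ})ᗮ), paramDiff n a b r s θ u =
      u.fst • axis n + (u.fst * r') • incl n θ + r s • incl n (u.snd : EuclideanSpace ℝ (Fin n)) :=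
    fun u => fderivWithin_param hab hs hr θ (u.fst, (u.snd : EuclideanSpace ℝ (Fin n)))
  have o1 : ∀ η : (Submodule.span ℝ {θ})ᗮ, inner ℝ θ (η : EuclideanSpace ℝ (Fin n)) = 0 :=
    fun η => Submodule.mem_orthogonal_singleton_iff_inner_right.1 η.2
  have o2 : ∀ η : (Submodule.span ℝ {θ})ᗮ, inner ℝ (η : EuclideanSpace ℝ (Fin n)) θ = 0 :=
    fun η => Submodule.mem_orthogonal_singleton_iff_inner_left.1 η.2
  rw [e, e]
  simp only [inner_add_left, inner_add_right, inner_smul_left, inner_smul_right, inner_axis,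
    inner_axis_left, incl_zero, inner_incl, o1, o2, real_inner_self_eq_norm_sq, norm_incl, hθ,
    norm_axis, Submodule.coe_inner]
  simp
  ring

/-- The Gram operator is `1 + r'²` on the line and `r²` on the `(n - 1)`-dimensional space `θ^⊥`;
the density is the root of its determinant. -/
lemma areaDensity_eq {a b : ℝ} (hab : a < b) {r : ℝ → ℝ} {r' s : ℝ}
    (hs : s ∈ Icc a b) (hr : HasDerivWithinAt r r' (Icc a b) s) (hpos : 0 ≤ r s)
    {θ : EuclideanSpace ℝ (Fin n)} (hθ : ‖θ‖ = 1) :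
    areaDensity n a b r s θ = r s ^ (n - 1) * √(1 + r' ^ 2) := by
  set e := WithLp.linearEquiv 2 ℝ (ℝ × (Submodule.span ℝ {θ})ᗮ) with he
  have h1 : (paramDiff n a b r s θ).adjoint ∘ₗ paramDiff n a b r s θ =
      e.symm.toLinearMap ∘ₗ (LinearMap.prodMap ((1 + r' ^ 2) • (LinearMap.id : ℝ →ₗ[ℝ] ℝ))
        ((r s ^ 2) • (LinearMap.id : (Submodule.span ℝ {θ})ᗮ →ₗ[ℝ] _))) ∘ₗ
        e.symm.symm.toLinearMap := by
    refine LinearMap.ext fun u => ext_inner_right ℝ fun w => ?_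
    rw [LinearMap.comp_apply, LinearMap.adjoint_inner_left, inner_paramDiff hab hs hr hθ,
      WithLp.prod_inner_apply]
    rfl
  have hfr : Module.finrank ℝ (Submodule.span ℝ {θ})ᗮ = n - 1 := by
    have h0 : θ ≠ 0 := by
      intro h; rw [h, norm_zero] at hθ; exact zero_ne_one hθ
    have := Submodule.finrank_add_finrank_orthogonal (Submodule.span ℝ {θ})
    rw [finrank_span_singleton h0, finrank_euclideanSpace_fin] at this
    omega
  rw [areaDensity, h1, LinearMap.det_conj, LinearMap.det_prodMap, LinearMap.det_smul,
    LinearMap.det_smul, LinearMap.det_id, LinearMap.det_id, hfr, Module.finrank_self, pow_one,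
    mul_one, mul_one, mul_comm, ← pow_mul, mul_comm 2, pow_mul, Real.sqrt_mul (by positivity),
    Real.sqrt_sq (by positivity)]

lemma surfIntegral_eq {a b : ℝ} (hab : a < b) {r q : ℝ → ℝ}
    (hr : ∀ s ∈ Icc a b, HasDerivWithinAt r (q s) (Icc a b) s) (hpos : ∀ s ∈ Icc a b, 0 ≤ r s)
    {f : Amb n → ℝ} {g : ℝ → ℝ}
    (hf : ∀ s ∈ Icc a b, ∀ θ : EuclideanSpace ℝ (Fin n), ‖θ‖ = 1 → f (param n r (s, θ)) = g s) :
    surfIntegral n a b r f =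
      (volume : Measure (EuclideanSpace ℝ (Fin n))).toSphere.real univ *
        ∫ s in a..b, g s * (r s ^ (n - 1) * √(1 + q s ^ 2)) := by
  rw [surfIntegral, intervalIntegral.integral_of_le hab.le, ← integral_Icc_eq_integral_Ioc,
    ← integral_const_mul]
  refine setIntegral_congr_fun measurableSet_Icc fun s hs => ?_
  have : ∀ θ : Metric.sphere (0 : EuclideanSpace ℝ (Fin n)) 1,
      f (param n r (s, (θ : EuclideanSpace ℝ (Fin n)))) * areaDensity n a b r s θ =
        g s * (r s ^ (n - 1) * √(1 + q s ^ 2)) := fun θ => by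
    have hθ : ‖(θ : EuclideanSpace ℝ (Fin n))‖ = 1 := mem_sphere_zero_iff_norm.1 θ.2
    rw [hf s hs _ hθ, areaDensity_eq hab hs (hr s hs) (hpos s hs) hθ]
  simp only [this, integral_const, smul_eq_mul]

/-- By symmetry both integrals carry the measure of the unit sphere as a factor. It cancels because
`1 ≤ n` makes it nonzero. -/
lemma avgMeanCurv_eq (hn : 1 ≤ n) {a b : ℝ} (hab : a < b) {r q p : ℝ → ℝ}
    (hr : ∀ s ∈ Icc a b, HasDerivWithinAt r (q s) (Icc a b) s)
    (hq : ∀ s ∈ Icc a b, HasDerivWithinAt q (p s) (Icc a b) s) (hpos : ∀ s ∈ Icc a b, 0 < r s) :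
    avgMeanCurv n a b r =
      (∫ s in a..b, ((n - 1) / (r s * √(1 + q s ^ 2)) - p s / √(1 + q s ^ 2) ^ 3) *
          (r s ^ (n - 1) * √(1 + q s ^ 2))) /
        ∫ s in a..b, r s ^ (n - 1) * √(1 + q s ^ 2) := by
  have : Nonempty (Fin n) := ⟨⟨0, hn⟩⟩
  have hσ : (volume : Measure (EuclideanSpace ℝ (Fin n))).toSphere.real univ ≠ 0 := by
    have h := Measure.toSphere_ne_zero (μ := (volume : Measure (EuclideanSpace ℝ (Fin n))))
    rw [measureReal_def]
    exact ENNReal.toReal_ne_zero.2 ⟨fun h0 => h (Measure.measure_univ_eq_zero.1 h0),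
      measure_ne_top _ _⟩
  rw [avgMeanCurv, surfIntegral_eq hab hr (fun s hs => (hpos s hs).le)
    (g := fun s => (n - 1) / (r s * √(1 + q s ^ 2)) - p s / √(1 + q s ^ 2) ^ 3),
    surfIntegral_eq hab hr (fun s hs => (hpos s hs).le) (f := fun _ => 1) (g := fun _ => 1)
      (fun _ _ _ _ => rfl), mul_div_mul_left _ _ hσ]
  · simp only [one_mul]
  · intro s hs θ hθ
    have hh : ‖hat (param n r (s, θ))‖ = r s := norm_hat_param (q := (s, θ)) hθ (hpos s hs).le
    have h0 : param n r (s, θ) 0 = s := param_zero r (s, θ)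
    rw [meanCurv_eq hab (q := q) (p := p s), hh, h0]
    · rw [slab, mem_ofPred_eq, h0]; exact hs
    · rw [← norm_ne_zero_iff, hh]; exact (hpos s hs).ne'
    · exact hr
    · rw [h0]; exact hq s hs

end Area

/-! ### From the motion of particles to the motion of the radius. -/

section Evolution

variable {n : ℕ} {a b T : ℝ} {ρ₀ : ℝ → ℝ}

/-- The normal velocity of the flow, read off the radius function. -/
lemma Flow.radius_evolution (hn : 1 ≤ n) (hab : a < b) (F : Flow n a b ρ₀ T) {t s : ℝ}
    (ht : t ∈ Ioo 0 T) (hs : s ∈ Icc a b) {q : ℝ → ℝ} {p ρt : ℝ} {f' : ℝ × ℝ →L[ℝ] ℝ}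
    (hq : ∀ s ∈ Icc a b, HasDerivWithinAt (F.radius t) (q s) (Icc a b) s)
    (hp : HasDerivWithinAt q p (Icc a b) s)
    (hf : HasFDerivWithinAt (fun z : ℝ × ℝ => F.radius z.1 z.2) f' (Ioo 0 T ×ˢ Icc a b) (t, s))
    (hft : f' (1, 0) = ρt) (hfs : f' (0, 1) = q s) :
    ρt = -(((n : ℝ) - 1) / (F.radius t s * √(1 + q s ^ 2)) - p / √(1 + q s ^ 2) ^ 3 -
      avgMeanCurv n a b (F.radius t)) * √(1 + q s ^ 2) := by
  have ht' : t ∈ Ico 0 T := ⟨ht.1.le, ht.2⟩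
  have hρ := F.radius_pos t ht' s hs
  -- Any point of `M_t` over `s` will do. The particle `l` that is there at time `t` satisfies `|x̂|
  -- = ρ(x₁)` at all times, and both sides are differentiated along its path.
  obtain ⟨θ, hθ⟩ : ∃ θ : EuclideanSpace ℝ (Fin n), ‖θ‖ = 1 :=
    ⟨EuclideanSpace.single ⟨0, hn⟩ 1, by simp⟩
  set x := param n (F.radius t) (s, θ) with hx
  have hh : ‖hat x‖ = F.radius t s := norm_hat_param (q := (s, θ)) hθ hρ.le
  have h0 : x 0 = s := param_zero _ (s, θ)
  have hxs : x ∈ slab n a b := by rw [slab, mem_ofPred_eq, h0]; exact hs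
  have hxM : x ∈ revolution n a b (F.radius t) := ⟨hxs, by rw [hh, h0]⟩
  have hx0 : hat x ≠ 0 := by rw [← norm_ne_zero_iff, hh]; exact hρ.ne'
  rw [← F.pos_image t ht'] at hxM
  obtain ⟨l, hl, hlx⟩ := hxM
  have hev := F.evolution l hl t ht
  rw [hlx] at hev
  have hmem : ∀ τ ∈ Ioo 0 T, F.pos τ l ∈ revolution n a b (F.radius τ) := fun τ hτ => by
    rw [← F.pos_image τ ⟨hτ.1.le, hτ.2⟩]; exact mem_image_of_mem _ hl
  set X := -(meanCurv a b (F.radius t) x - avgMeanCurv n a b (F.radius t)) •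
    normal a b (F.radius t) x with hX
  have hd1 : HasDerivAt (fun τ => ‖hat (F.pos τ l)‖) (inner ℝ (omega x) X) t := by
    have := hasFDerivAt_norm_hat hx0
    rw [← hlx] at this
    have h := this.comp_hasDerivAt t hev
    rw [hlx] at h
    exact h
  have hd0 : HasDerivAt (fun τ => F.pos τ l 0) (X 0) t :=
    (EuclideanSpace.proj 0 : Amb n →L[ℝ] ℝ).hasFDerivAt.comp_hasDerivAt t hev
  have hd2 : HasDerivWithinAt (fun τ => F.radius τ (F.pos τ l 0)) (f' (1, X 0)) (Ioo 0 T) t := by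
    have hz : HasDerivWithinAt (fun τ => (τ, F.pos τ l 0)) (1, X 0) (Ioo 0 T) t :=
      ((hasDerivAt_id t).prodMk hd0).hasDerivWithinAt
    have hf2 : HasFDerivWithinAt (fun z : ℝ × ℝ => F.radius z.1 z.2) f' (Ioo 0 T ×ˢ Icc a b)
        (t, F.pos t l 0) := by rw [hlx, h0]; exact hf
    exact HasFDerivWithinAt.comp_hasDerivWithinAt (t := Ioo 0 T ×ˢ Icc a b) t hf2 hz
      (fun τ hτ => ⟨hτ, (hmem τ hτ).1⟩)
  have hd3 : HasDerivAt (fun τ => ‖hat (F.pos τ l)‖) (f' (1, X 0)) t := by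
    refine (hd2.hasDerivAt (Ioo_mem_nhds ht.1 ht.2)).congr_of_eventuallyEq ?_
    filter_upwards [Ioo_mem_nhds ht.1 ht.2] with τ hτ
    exact (hmem τ hτ).2
  -- This is `⟨ω, X⟩ = ∂ₜρ + X₁ ∂ₛρ` for the velocity `X`, where the last term accounts for the
  -- axial drift of the particle.
  have hd4 := hd1.unique hd3
  have hf1 : f' (1, X 0) = ρt + X 0 * q s := by
    rw [← hft, ← hfs, ← smul_eq_mul, ← map_smul, ← map_add]; simp
  rw [hf1] at hd4
  have hv2 : √(1 + q s ^ 2) ^ 2 = 1 + q s ^ 2 := Real.sq_sqrt (by positivity)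
  have hv : 0 < √(1 + q s ^ 2) := Real.sqrt_pos.2 (by positivity)
  have hν := normal_eq hab hxs hx0 (r := F.radius t) (by rw [h0]; exact hq s hs)
  have hH := meanCurv_eq hab hxs hx0 hq (p := p) (by rw [h0]; exact hp)
  rw [h0] at hH
  rw [hh] at hH
  have i1 : inner ℝ (omega x) (omega x - q s • axis n) = 1 := by
    simpa using inner_conormal hx0 0 (q s)
  rw [hX, hν, hH, inner_smul_right, inner_smul_right, i1] at hd4
  simp only [PiLp.smul_apply, PiLp.sub_apply, omega_zero, axis_zero, smul_eq_mul] at hd4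
  generalize ((n : ℝ) - 1) / (F.radius t s * √(1 + q s ^ 2)) - p / √(1 + q s ^ 2) ^ 3 -
      avgMeanCurv n a b (F.radius t) = K at *
  have h5 : ρt = -K * (√(1 + q s ^ 2))⁻¹ * (1 + q s ^ 2) := by linear_combination -hd4
  rw [h5]
  field_simp
  rw [hv2]

end Evolution

/-! ### Partial derivatives on the strip `(0, T) × [a, b]`, up to its lateral boundary. -/

section Strip

/-- The partial derivative in the direction `e`, from within the strip `(0, T) × [a, b]`. -/
noncomputable def stripDeriv (a b T : ℝ) (e : ℝ × ℝ) (f : ℝ × ℝ → ℝ) (z : ℝ × ℝ) : ℝ :=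
  fderivWithin ℝ f (Ioo 0 T ×ˢ Icc a b) z e

variable {a b T : ℝ}

lemma uniqueDiffOn_strip (hab : a < b) : UniqueDiffOn ℝ (Ioo 0 T ×ˢ Icc a b) :=
  isOpen_Ioo.uniqueDiffOn.prod (uniqueDiffOn_Icc hab)

lemma hasFDerivWithinAt_strip {f : ℝ × ℝ → ℝ}
    (hf : ContDiffOn ℝ ∞ f (Ioo 0 T ×ˢ Icc a b)) {z : ℝ × ℝ} (hz : z ∈ Ioo 0 T ×ˢ Icc a b) :
    HasFDerivWithinAt f (fderivWithin ℝ f (Ioo 0 T ×ˢ Icc a b) z) (Ioo 0 T ×ˢ Icc a b) z :=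
  (hf.differentiableOn (by simp) z hz).hasFDerivWithinAt

lemma contDiffOn_stripDeriv (hab : a < b) {f : ℝ × ℝ → ℝ}
    (hf : ContDiffOn ℝ ∞ f (Ioo 0 T ×ˢ Icc a b)) (e : ℝ × ℝ) :
    ContDiffOn ℝ ∞ (stripDeriv a b T e f) (Ioo 0 T ×ˢ Icc a b) :=
  (hf.fderivWithin (uniqueDiffOn_strip hab) (by simp)).clm_apply contDiffOn_const

lemma hasDerivWithinAt_stripDeriv {f : ℝ × ℝ → ℝ}
    (hf : ContDiffOn ℝ ∞ f (Ioo 0 T ×ˢ Icc a b)) {t s : ℝ} (ht : t ∈ Ioo 0 T) (hs : s ∈ Icc a b) :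
    HasDerivWithinAt (fun σ => f (t, σ)) (stripDeriv a b T (0, 1) f (t, s))
      (Icc a b) s :=
  HasFDerivWithinAt.comp_hasDerivWithinAt (t := Ioo 0 T ×ˢ Icc a b) s
    (hasFDerivWithinAt_strip hf ⟨ht, hs⟩)
    ((hasDerivWithinAt_const s _ t).prodMk (hasDerivWithinAt_id s _)) (fun _ hσ => ⟨ht, hσ⟩)

lemma hasDerivAt_stripDeriv {f : ℝ × ℝ → ℝ}
    (hf : ContDiffOn ℝ ∞ f (Ioo 0 T ×ˢ Icc a b)) {t s : ℝ} (ht : t ∈ Ioo 0 T) (hs : s ∈ Icc a b) :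
    HasDerivAt (fun τ => f (τ, s)) (stripDeriv a b T (1, 0) f (t, s)) t :=
  (HasFDerivWithinAt.comp_hasDerivWithinAt (t := Ioo 0 T ×ˢ Icc a b) (s := Ioo 0 T) t
    (hasFDerivWithinAt_strip hf ⟨ht, hs⟩)
    ((hasDerivWithinAt_id t _).prodMk (hasDerivWithinAt_const t _ s))
      (fun _ hτ => ⟨hτ, hs⟩)).hasDerivAt (Ioo_mem_nhds ht.1 ht.2)

/-- Every point of the strip lies in the closure of its interior, so second derivatives are
symmetric at the end points too. This identifies `∂ₜ∂ₛρ` with `∂ₛ∂ₜρ`. -/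
lemma stripDeriv_comm (hab : a < b) {f : ℝ × ℝ → ℝ}
    (hf : ContDiffOn ℝ ∞ f (Ioo 0 T ×ˢ Icc a b)) {z : ℝ × ℝ} (hz : z ∈ Ioo 0 T ×ˢ Icc a b)
    (e e' : ℝ × ℝ) :
    stripDeriv a b T e (stripDeriv a b T e' f) z = stripDeriv a b T e' (stripDeriv a b T e f) z := by
  have hu := uniqueDiffOn_strip (T := T) hab
  have hint : z ∈ closure (interior (Ioo 0 T ×ˢ Icc a b)) := by
    rw [interior_prod_eq, closure_prod_eq, isOpen_Ioo.interior_eq, interior_Icc,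
      closure_Ioo hab.ne]
    exact ⟨subset_closure hz.1, hz.2⟩
  have hsym := (hf z hz).isSymmSndFDerivWithinAt (by simpa using WithTop.coe_le_coe.2 (le_top : (2 : ℕ∞) ≤ ⊤)) hu hint hz
  have hd : DifferentiableWithinAt ℝ (fderivWithin ℝ f (Ioo 0 T ×ˢ Icc a b))
      (Ioo 0 T ×ˢ Icc a b) z :=
    (hf.fderivWithin hu (m := ∞) (by simp)).differentiableOn (by simp) z hz
  have key : ∀ e e', stripDeriv a b T e (stripDeriv a b T e' f) z =
      fderivWithin ℝ (fderivWithin ℝ f (Ioo 0 T ×ˢ Icc a b)) (Ioo 0 T ×ˢ Icc a b) z e e' := by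
    intro e e'
    have h := (hd.hasFDerivWithinAt.clm_apply
      (hasFDerivWithinAt_const e' z (Ioo 0 T ×ˢ Icc a b))).fderivWithin (hu z hz)
    change fderivWithin ℝ (fun y => fderivWithin ℝ f (Ioo 0 T ×ˢ Icc a b) y e') _ z e = _
    rw [h]
    simp
  rw [key, key]
  exact hsym e e'

end Strip

/-! ### Reduction of the flow to a scalar parabolic problem. -/

/-- The equations satisfied by the radius function `ρ` of the flow, its derivatives
`q = ∂ₛρ`, `p = ∂ₛ²ρ`, `m = ∂ₛ³ρ`, `ρt = ∂ₜρ`, `qt = ∂ₜ∂ₛρ`, and the average `h` of the mean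
curvature. -/
structure IsRadialFlow (n : ℕ) (a b T : ℝ) (ρ q p m ρt qt : ℝ → ℝ → ℝ) (h : ℝ → ℝ) : Prop where
  pos : ∀ t ∈ Ico 0 T, ∀ s ∈ Icc a b, 0 < ρ t s
  cont : ContinuousOn (fun z : ℝ × ℝ => ρ z.1 z.2) (Ico 0 T ×ˢ Icc a b)
  cont_q : ContinuousOn (fun z : ℝ × ℝ => q z.1 z.2) (Ico 0 T ×ˢ Icc a b)
  cont_p : ContinuousOn (fun z : ℝ × ℝ => p z.1 z.2) (Ioo 0 T ×ˢ Icc a b)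
  cont_ρt : ContinuousOn (fun z : ℝ × ℝ => ρt z.1 z.2) (Ioo 0 T ×ˢ Icc a b)
  cont_qt : ContinuousOn (fun z : ℝ × ℝ => qt z.1 z.2) (Ioo 0 T ×ˢ Icc a b)
  space : ∀ t ∈ Ioo 0 T, ∀ s ∈ Icc a b, HasDerivWithinAt (ρ t) (q t s) (Icc a b) s
  space_q : ∀ t ∈ Ioo 0 T, ∀ s ∈ Icc a b, HasDerivWithinAt (q t) (p t s) (Icc a b) s
  space_p : ∀ t ∈ Ioo 0 T, ∀ s ∈ Icc a b, HasDerivWithinAt (p t) (m t s) (Icc a b) s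
  space_ρt : ∀ t ∈ Ioo 0 T, ∀ s ∈ Icc a b, HasDerivWithinAt (ρt t) (qt t s) (Icc a b) s
  time : ∀ t ∈ Ioo 0 T, ∀ s ∈ Icc a b, HasDerivAt (fun τ => ρ τ s) (ρt t s) t
  time_q : ∀ t ∈ Ioo 0 T, ∀ s ∈ Icc a b, HasDerivAt (fun τ => q τ s) (qt t s) t
  neumann_left : ∀ t ∈ Ioo 0 T, q t a = 0
  neumann_right : ∀ t ∈ Ioo 0 T, q t b = 0
  evolution : ∀ t ∈ Ioo 0 T, ∀ s ∈ Icc a b,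
    ρt t s = -(((n : ℝ) - 1) / (ρ t s * √(1 + q t s ^ 2)) - p t s / √(1 + q t s ^ 2) ^ 3 - h t) *
      √(1 + q t s ^ 2)
  avg : ∀ t ∈ Ioo 0 T, h t =
    (∫ s in a..b, (((n : ℝ) - 1) / (ρ t s * √(1 + q t s ^ 2)) - p t s / √(1 + q t s ^ 2) ^ 3) *
      (ρ t s ^ (n - 1) * √(1 + q t s ^ 2))) / ∫ s in a..b, ρ t s ^ (n - 1) * √(1 + q t s ^ 2)

/-- The slope is given explicitly, since it is needed down to `t = 0`; the other derivatives are
only used for `t > 0`. -/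
theorem Flow.exists_isRadialFlow {n : ℕ} (hn : 1 ≤ n) {a b T : ℝ} (hab : a < b) {ρ₀ : ℝ → ℝ}
    (F : Flow n a b ρ₀ T) :
    ∃ p m ρt qt : ℝ → ℝ → ℝ, ∃ h : ℝ → ℝ, IsRadialFlow n a b T F.radius
      (fun t s => derivWithin (F.radius t) (Icc a b) s) p m ρt qt h := by
  set f : ℝ × ℝ → ℝ := fun z => F.radius z.1 z.2 with hfdef
  have hf : ContDiffOn ℝ ∞ f (Ioo 0 T ×ˢ Icc a b) := F.radius_smooth
  have hf1 := contDiffOn_stripDeriv hab hf (0, 1)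
  have hf2 := contDiffOn_stripDeriv hab hf1 (0, 1)
  have hft := contDiffOn_stripDeriv hab hf (1, 0)
  have hft1 := contDiffOn_stripDeriv hab hft (0, 1)
  have hq : ∀ t ∈ Ioo 0 T, ∀ s ∈ Icc a b,
      derivWithin (F.radius t) (Icc a b) s = stripDeriv a b T (0, 1) f (t, s) :=
    fun t ht s hs => (hasDerivWithinAt_stripDeriv hf ht hs).derivWithin
      (uniqueDiffOn_Icc hab s hs)
  have hs1 : ∀ t ∈ Ioo 0 T, ∀ s ∈ Icc a b,
      HasDerivWithinAt (F.radius t) (derivWithin (F.radius t) (Icc a b) s) (Icc a b) s :=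
    fun t ht s hs => by
      rw [hq t ht s hs]; exact hasDerivWithinAt_stripDeriv hf ht hs
  have hs2 : ∀ t ∈ Ioo 0 T, ∀ s ∈ Icc a b,
      HasDerivWithinAt (fun s => derivWithin (F.radius t) (Icc a b) s)
        (stripDeriv a b T (0, 1) (stripDeriv a b T (0, 1) f) (t, s)) (Icc a b) s :=
    fun t ht s hs => (hasDerivWithinAt_stripDeriv hf1 ht hs).congr
      (fun σ hσ => hq t ht σ hσ) (hq t ht s hs)
  refine ⟨fun t s => stripDeriv a b T (0, 1) (stripDeriv a b T (0, 1) f) (t, s),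
    fun t s => stripDeriv a b T (0, 1) (stripDeriv a b T (0, 1) (stripDeriv a b T (0, 1) f)) (t, s),
    fun t s => stripDeriv a b T (1, 0) f (t, s),
    fun t s => stripDeriv a b T (0, 1) (stripDeriv a b T (1, 0) f) (t, s),
    fun t => avgMeanCurv n a b (F.radius t), ?_⟩
  exact
  { pos := F.radius_pos
    cont := F.radius_cont
    cont_q := F.radius_deriv_cont
    cont_p := hf2.continuousOn
    cont_ρt := hft.continuousOn
    cont_qt := hft1.continuousOn
    space := hs1
    space_q := hs2
    space_p := fun t ht s hs => hasDerivWithinAt_stripDeriv hf2 ht hs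
    space_ρt := fun t ht s hs => hasDerivWithinAt_stripDeriv hft ht hs
    time := fun t ht s hs => hasDerivAt_stripDeriv hf ht hs
    time_q := fun t ht s hs => by
      rw [stripDeriv_comm hab hf ⟨ht, hs⟩]
      refine (hasDerivAt_stripDeriv hf1 ht hs).congr_of_eventuallyEq ?_
      filter_upwards [Ioo_mem_nhds ht.1 ht.2] with τ hτ
      exact hq τ hτ s hs
    neumann_left := fun t ht => F.neumann_left t ⟨ht.1.le, ht.2⟩
    neumann_right := fun t ht => F.neumann_right t ⟨ht.1.le, ht.2⟩
    evolution := fun t ht s hs => F.radius_evolution hn hab ht hs (hs1 t ht) (hs2 t ht s hs)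
      (hasFDerivWithinAt_strip hf ⟨ht, hs⟩) rfl (hq t ht s hs).symm
    avg := fun t ht => avgMeanCurv_eq hn hab (hs1 t ht) (hs2 t ht)
      (F.radius_pos t ⟨ht.1.le, ht.2⟩) }

/-! ### Parameter integrals and derivative tests at a maximum. -/

section Calculus

variable {a b T : ℝ}

/-- Compactness of `[a, b]` makes the slices converge uniformly. The set `D` is arbitrary so that
the initial time can be included. -/
lemma continuousOn_intervalIntegral (hab : a < b) {D : Set ℝ} {f : ℝ → ℝ → ℝ}
    (hf : ContinuousOn (fun z : ℝ × ℝ => f z.1 z.2) (D ×ˢ Icc a b)) :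
    ContinuousOn (fun t => ∫ s in a..b, f t s) D := by
  have hslice : ∀ t ∈ D, IntervalIntegrable (f t) volume a b := fun t ht => by
    refine ContinuousOn.intervalIntegrable_of_Icc hab.le ?_
    exact hf.comp (Continuous.continuousOn (by fun_prop : Continuous fun s : ℝ => (t, s)))
      (fun s hs => ⟨ht, hs⟩)
  intro t ht
  rw [ContinuousWithinAt, Metric.tendsto_nhds]
  intro ε hε
  have hε' : 0 < ε / (2 * (b - a)) := div_pos hε (by linarith)
  obtain ⟨v, hv, h⟩ := isCompact_Icc.mem_uniformity_of_prod (f := f) (k := Icc a b) hf ht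
    (Metric.dist_mem_uniformity hε')
  filter_upwards [hv, self_mem_nhdsWithin] with τ hτ hτD
  rw [Real.dist_eq, ← intervalIntegral.integral_sub (hslice τ hτD) (hslice t ht)]
  have hb := intervalIntegral.norm_integral_le_of_norm_le_const (a := a) (b := b)
    (f := fun s => f τ s - f t s) (C := ε / (2 * (b - a))) (fun s hs => by
      rw [uIoc_of_le hab.le] at hs
      have := h τ hτ s (Ioc_subset_Icc_self hs)
      exact (le_of_lt this : dist (f τ s) (f t s) ≤ _))
  rw [abs_of_pos (by linarith : 0 < b - a), Real.norm_eq_abs] at hb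
  have : ε / (2 * (b - a)) * (b - a) = ε / 2 := by
    have : b - a ≠ 0 := by linarith
    field_simp
  linarith

lemma continuousOn_slice {D : Set ℝ} {f : ℝ → ℝ → ℝ}
    (hf : ContinuousOn (fun z : ℝ × ℝ => f z.1 z.2) (D ×ˢ Icc a b)) {t : ℝ} (ht : t ∈ D) :
    ContinuousOn (f t) (Icc a b) :=
  hf.comp (Continuous.continuousOn (by fun_prop : Continuous fun s : ℝ => (t, s)))
    (fun _ hs => ⟨ht, hs⟩)

/-- Differentiation under the integral sign. -/
lemma hasDerivAt_intervalIntegral (hab : a < b) {f ft : ℝ → ℝ → ℝ}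
    (hf : ∀ t ∈ Ioo 0 T, ContinuousOn (f t) (Icc a b))
    (hft : ContinuousOn (fun z : ℝ × ℝ => ft z.1 z.2) (Ioo 0 T ×ˢ Icc a b))
    (hd : ∀ t ∈ Ioo 0 T, ∀ s ∈ Icc a b, HasDerivAt (fun τ => f τ s) (ft t s) t)
    {t : ℝ} (ht : t ∈ Ioo 0 T) :
    HasDerivAt (fun τ => ∫ s in a..b, f τ s) (∫ s in a..b, ft t s) t := by
  -- A compact time interval around `t` inside `(0, T)`; the bound on it serves as the dominating
  -- constant.
  obtain ⟨C, hC⟩ : ∃ C, ∀ z ∈ Icc (t / 2) ((t + T) / 2) ×ˢ Icc a b, ‖ft z.1 z.2‖ ≤ C := by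
    refine (isCompact_Icc.prod isCompact_Icc).exists_bound_of_continuousOn (hft.mono ?_)
    rintro ⟨τ, s⟩ ⟨hτ, hs⟩
    refine ⟨⟨?_, ?_⟩, hs⟩
    · have := hτ.1; have := ht.1; simp only at *; linarith
    · have := hτ.2; have := ht.2; simp only at *; linarith
  have hsub : uIoc a b ⊆ Icc a b := by rw [uIoc_of_le hab.le]; exact Ioc_subset_Icc_self
  have hmeas : ∀ {g : ℝ → ℝ}, ContinuousOn g (Icc a b) →
      AEStronglyMeasurable g (volume.restrict (uIoc a b)) := fun hg =>
    (hg.mono hsub).aestronglyMeasurable measurableSet_uIoc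
  have hs2 : Icc (t / 2) ((t + T) / 2) ⊆ Ioo 0 T := fun τ hτ =>
    ⟨by have := hτ.1; have := ht.1; linarith, by have := hτ.2; have := ht.2; linarith⟩
  refine (intervalIntegral.hasDerivAt_integral_of_dominated_loc_of_deriv_le
    (bound := fun _ => C) (s := Icc (t / 2) ((t + T) / 2)) (F := f) (F' := ft)
    (Icc_mem_nhds (by have := ht.1; linarith) (by have := ht.2; linarith)) ?_
    ((hf t ht).intervalIntegrable_of_Icc hab.le) (hmeas (continuousOn_slice hft ht)) ?_
    (by simp) ?_).2
  · filter_upwards [Ioo_mem_nhds ht.1 ht.2] with τ hτ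
    exact hmeas (hf τ hτ)
  · exact Filter.Eventually.of_forall fun s hs τ hτ => hC (τ, s) ⟨hτ, hsub hs⟩
  · exact Filter.Eventually.of_forall fun s hs τ hτ => hd τ (hs2 hτ) s (hsub hs)

lemma integral_eq_sub_of_hasDerivWithinAt_Icc (hab : a < b) {f f' : ℝ → ℝ}
    (hf : ∀ s ∈ Icc a b, HasDerivWithinAt f (f' s) (Icc a b) s)
    (hf' : ContinuousOn f' (Icc a b)) : ∫ s in a..b, f' s = f b - f a :=
  intervalIntegral.integral_eq_sub_of_hasDerivAt_of_le hab.le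
    (fun s hs => (hf s hs).continuousWithinAt)
    (fun s hs => (hf s (Ioo_subset_Icc_self hs)).hasDerivAt (Icc_mem_nhds hs.1 hs.2))
    (hf'.intervalIntegrable_of_Icc hab.le)

/-- At a maximum point on `[a, b]` where the first derivative vanishes, the second derivative is
nonpositive, also if the point is an end point. -/
lemma second_deriv_nonpos_of_isMaxOn (hab : a < b) {f f' : ℝ → ℝ} {f'' c : ℝ} (hc : c ∈ Icc a b)
    (hf : ∀ s ∈ Icc a b, HasDerivWithinAt f (f' s) (Icc a b) s)
    (hf' : HasDerivWithinAt f' f'' (Icc a b) c) (h0 : f' c = 0) (hmax : IsMaxOn f (Icc a b) c) :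
    f'' ≤ 0 := by
  by_contra! hpos
  rw [hasDerivWithinAt_iff_tendsto_slope] at hf'
  have hev := hf'.eventually (lt_mem_nhds hpos)
  rw [eventually_nhdsWithin_iff, Metric.eventually_nhds_iff] at hev
  obtain ⟨δ, hδ, hev⟩ := hev
  have hcont : ContinuousOn f (Icc a b) := fun s hs => (hf s hs).continuousWithinAt
  have hd : ∀ s ∈ Ioo a b, HasDerivAt f (f' s) s := fun s hs =>
    (hf s (Ioo_subset_Icc_self hs)).hasDerivAt (Icc_mem_nhds hs.1 hs.2)
  have hsl : ∀ s ∈ Icc a b, s ≠ c → |s - c| < δ → 0 < (s - c)⁻¹ * f' s := fun s hs hne hsc => by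
    have := hev (y := s) (by rwa [Real.dist_eq]) ⟨hs, hne⟩
    simpa [slope_def_field, h0, div_eq_inv_mul] using this
  -- If `f''` were positive, `f` would increase strictly on moving away from `c`, by the mean value
  -- theorem. The move goes to the right if `c < b` and to the left if `c = b`, staying inside `[a,
  -- b]`.
  rcases hc.2.lt_or_eq with hcb | hcb
  · set d := c + min (δ / 2) (b - c) with hdd
    have h1 : 0 < min (δ / 2) (b - c) := lt_min (by linarith) (by linarith)
    have h2 := min_le_left (δ / 2) (b - c)
    have h3 := min_le_right (δ / 2) (b - c)
    have hdb : d ≤ b := by linarith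
    obtain ⟨ξ, hξ, he⟩ := exists_hasDerivAt_eq_slope f f' (by linarith : c < d)
      (hcont.mono (Icc_subset_Icc hc.1 hdb))
      (fun s hs => hd s ⟨hc.1.trans_lt hs.1, hs.2.trans_le hdb⟩)
    have h4 := hsl ξ ⟨hc.1.trans hξ.1.le, hξ.2.le.trans hdb⟩ hξ.1.ne'
      (by rw [abs_of_pos (by linarith [hξ.1])]; linarith [hξ.2])
    have h5 : 0 < f' ξ := pos_of_mul_pos_right h4 (inv_nonneg.2 (by linarith [hξ.1]))
    rw [he] at h5
    have h6 : f d ≤ f c := hmax ⟨by linarith [hc.1], hdb⟩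
    exact absurd h5 (not_lt.2 (div_nonpos_of_nonpos_of_nonneg (by linarith) (by linarith)))
  · have hac : a < c := by rw [hcb]; exact hab
    set d := c - min (δ / 2) (c - a) with hdd
    have h1 : 0 < min (δ / 2) (c - a) := lt_min (by linarith) (by linarith)
    have h2 := min_le_left (δ / 2) (c - a)
    have h3 := min_le_right (δ / 2) (c - a)
    have hda : a ≤ d := by linarith
    obtain ⟨ξ, hξ, he⟩ := exists_hasDerivAt_eq_slope f f' (by linarith : d < c)
      (hcont.mono (Icc_subset_Icc hda hc.2))
      (fun s hs => hd s ⟨hda.trans_lt hs.1, hs.2.trans_le hc.2⟩)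
    have h4 := hsl ξ ⟨hda.trans hξ.1.le, hξ.2.le.trans hc.2⟩ hξ.2.ne
      (by rw [abs_of_neg (by linarith [hξ.2])]; linarith [hξ.1])
    have h5 : f' ξ < 0 := by
      by_contra! h
      exact absurd h4 (not_lt.2 (mul_nonpos_of_nonpos_of_nonneg
        (inv_nonpos.2 (by linarith [hξ.2])) h))
    rw [he] at h5
    have h6 : f d ≤ f c := hmax ⟨hda, by linarith [hc.2]⟩
    exact absurd h5 (not_lt.2 (div_nonneg (by linarith) (by linarith)))

lemma deriv_eq_zero_of_isMaxOn {f : ℝ → ℝ} {f' c : ℝ} (hc : c ∈ Ioo a b)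
    (hf : HasDerivWithinAt f f' (Icc a b) c) (hmax : IsMaxOn f (Icc a b) c) : f' = 0 :=
  (hmax.isLocalMax (Icc_mem_nhds hc.1 hc.2)).hasDerivAt_eq_zero
    (hf.hasDerivAt (Icc_mem_nhds hc.1 hc.2))

/-- Only left difference quotients are used, because the maximum may occur at the final time of a
compact interval. -/
lemma deriv_nonneg_of_forall_le_left {f : ℝ → ℝ} {f' c t : ℝ} (hc : c < t)
    (hf : HasDerivAt f f' t) (hmax : ∀ τ ∈ Ioo c t, f τ ≤ f t) : 0 ≤ f' := by
  have h := (hasDerivAt_iff_tendsto_slope_left_right.1 hf).1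
  refine ge_of_tendsto h ?_
  filter_upwards [Ioo_mem_nhdsLT hc] with τ hτ
  rw [slope_def_field]
  exact div_nonneg_of_nonpos (by linarith [hmax τ hτ]) (by linarith [hτ.2])

end Calculus

/-! ### Preserved volume, decreasing area and the bound on the radius. -/

namespace IsRadialFlow

variable {n : ℕ} {a b T : ℝ} {ρ q p m ρt qt : ℝ → ℝ → ℝ} {h : ℝ → ℝ}

lemma sqrt_pos (x : ℝ) : 0 < √(1 + x ^ 2) := Real.sqrt_pos.2 (by positivity)

lemma sq_sqrt (x : ℝ) : √(1 + x ^ 2) ^ 2 = 1 + x ^ 2 := Real.sq_sqrt (by positivity)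

lemma one_le_sqrt (x : ℝ) : 1 ≤ √(1 + x ^ 2) := Real.one_le_sqrt.2 (by nlinarith [sq_nonneg x])

lemma abs_le_sqrt (x : ℝ) : |x| ≤ √(1 + x ^ 2) := Real.abs_le_sqrt (by linarith)

lemma continuousOn_ρ (H : IsRadialFlow n a b T ρ q p m ρt qt h) {t : ℝ} (ht : t ∈ Ico 0 T) :
    ContinuousOn (ρ t) (Icc a b) := continuousOn_slice H.cont ht

lemma continuousOn_q (H : IsRadialFlow n a b T ρ q p m ρt qt h) {t : ℝ} (ht : t ∈ Ico 0 T) :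
    ContinuousOn (q t) (Icc a b) := continuousOn_slice H.cont_q ht

lemma continuousOn_p (H : IsRadialFlow n a b T ρ q p m ρt qt h) {t : ℝ} (ht : t ∈ Ioo 0 T) :
    ContinuousOn (p t) (Icc a b) := continuousOn_slice H.cont_p ht

lemma continuousOn_ρt (H : IsRadialFlow n a b T ρ q p m ρt qt h) {t : ℝ} (ht : t ∈ Ioo 0 T) :
    ContinuousOn (ρt t) (Icc a b) := continuousOn_slice H.cont_ρt ht

lemma continuousOn_qt (H : IsRadialFlow n a b T ρ q p m ρt qt h) {t : ℝ} (ht : t ∈ Ioo 0 T) :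
    ContinuousOn (qt t) (Icc a b) := continuousOn_slice H.cont_qt ht

/-- The area of the hypersurface generated by a radius function with derivative `q`, up to the
area of the unit sphere. -/
noncomputable def area (n : ℕ) (a b : ℝ) (r q : ℝ → ℝ) : ℝ :=
  ∫ s in a..b, r s ^ (n - 1) * √(1 + q s ^ 2)

/-- The total mean curvature of the hypersurface, up to the area of the unit sphere, after an
integration by parts. -/
noncomputable def totalCurv (n : ℕ) (a b : ℝ) (r q : ℝ → ℝ) : ℝ :=
  ∫ s in a..b, ((n : ℝ) - 1) * r s ^ (n - 2) * (1 + q s * Real.arctan (q s))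

lemma area_pos (hab : a < b) {r q : ℝ → ℝ} (hr : ContinuousOn r (Icc a b))
    (hq : ContinuousOn q (Icc a b)) (hpos : ∀ s ∈ Icc a b, 0 < r s) : 0 < area n a b r q := by
  refine intervalIntegral.intervalIntegral_pos_of_pos_on
    (ContinuousOn.intervalIntegrable_of_Icc hab.le (by fun_prop)) (fun s hs => ?_) hab
  have := hpos s (Ioo_subset_Icc_self hs)
  have := sqrt_pos (q s)
  positivity

/-- Integration by parts for the term `∂ₛ arctan (∂ₛ ρ)`. -/
lemma integral_pow_mul_deriv_arctan (H : IsRadialFlow n a b T ρ q p m ρt qt h) (hab : a < b)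
    {t : ℝ} (ht : t ∈ Ioo 0 T) (k : ℕ) :
    ∫ s in a..b, ρ t s ^ k * (p t s / (1 + q t s ^ 2)) =
      -∫ s in a..b, k * ρ t s ^ (k - 1) * (q t s * Real.arctan (q t s)) := by
  have ht' : t ∈ Ico 0 T := ⟨ht.1.le, ht.2⟩
  have hρ := H.continuousOn_ρ ht'
  have hq := H.continuousOn_q ht'
  have hp := H.continuousOn_p ht
  have hne : ∀ s ∈ Icc a b, 1 + q t s ^ 2 ≠ 0 := fun s _ => by positivity
  have c1 : ContinuousOn (fun s => ρ t s ^ k * (p t s / (1 + q t s ^ 2))) (Icc a b) := by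
    fun_prop (disch := assumption)
  have c2 : ContinuousOn (fun s => k * ρ t s ^ (k - 1) * (q t s * Real.arctan (q t s)))
      (Icc a b) := by
    have := Real.continuous_arctan.comp_continuousOn hq
    simp only [Function.comp_def] at this
    fun_prop
  have := integral_eq_sub_of_hasDerivWithinAt_Icc hab
    (f := fun s => ρ t s ^ k * Real.arctan (q t s))
    (f' := fun s => ρ t s ^ k * (p t s / (1 + q t s ^ 2)) +
      k * ρ t s ^ (k - 1) * (q t s * Real.arctan (q t s))) (fun s hs => by
      refine (((H.space t ht s hs).pow k).mul (H.space_q t ht s hs).arctan).congr_deriv ?_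
      simp
      ring) (c1.add c2)
  rw [intervalIntegral.integral_add (c1.intervalIntegrable_of_Icc hab.le)
    (c2.intervalIntegrable_of_Icc hab.le), H.neumann_left t ht, H.neumann_right t ht] at this
  simp only [Real.arctan_zero, mul_zero, sub_zero] at this
  linarith

/-- The evolution equation of the radius function in non-geometric form. -/
lemma evolution' (H : IsRadialFlow n a b T ρ q p m ρt qt h)
    {t s : ℝ} (ht : t ∈ Ioo 0 T) (hs : s ∈ Icc a b) :
    ρt t s = p t s / (1 + q t s ^ 2) - ((n : ℝ) - 1) / ρ t s + h t * √(1 + q t s ^ 2) := by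
  rw [H.evolution t ht s hs, ← sq_sqrt (q t s), Real.sqrt_sq (sqrt_pos _).le]
  have h1 := H.pos t ⟨ht.1.le, ht.2⟩ s hs
  have h2 := sqrt_pos (q t s)
  field_simp
  ring

/-- For `n = 1` the exponent `n - 2` truncates to `0`, which is harmless because the factor `n - 1`
vanishes. -/
lemma cast_sub_one_mul_pow (hn : 1 ≤ n) {x : ℝ} (hx : x ≠ 0) :
    ((n : ℝ) - 1) / x * x ^ (n - 1) = ((n : ℝ) - 1) * x ^ (n - 2) := by
  rcases hn.eq_or_lt with rfl | hn
  · simp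
  · have : n - 1 = (n - 2) + 1 := by omega
    rw [this, pow_succ]
    field_simp

/-- Integration by parts removes the second derivative from `h`. Its sign and its Lipschitz
dependence on `ρ` and `q` are read off this form. -/
lemma avg_eq (H : IsRadialFlow n a b T ρ q p m ρt qt h) (hn : 1 ≤ n) (hab : a < b)
    {t : ℝ} (ht : t ∈ Ioo 0 T) :
    h t = totalCurv n a b (ρ t) (q t) / area n a b (ρ t) (q t) := by
  have ht' : t ∈ Ico 0 T := ⟨ht.1.le, ht.2⟩
  have hρ := H.continuousOn_ρ ht'
  have hq := H.continuousOn_q ht'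
  have hp := H.continuousOn_p ht
  have hne : ∀ s ∈ Icc a b, 1 + q t s ^ 2 ≠ 0 := fun s _ => by positivity
  have hat : ContinuousOn (fun s => Real.arctan (q t s)) (Icc a b) :=
    Real.continuous_arctan.comp_continuousOn hq
  have hbp := H.integral_pow_mul_deriv_arctan hab ht (n - 1)
  rw [H.avg t ht, area]
  congr 1
  have e1 : ∫ s in a..b, (((n : ℝ) - 1) / (ρ t s * √(1 + q t s ^ 2)) -
      p t s / √(1 + q t s ^ 2) ^ 3) * (ρ t s ^ (n - 1) * √(1 + q t s ^ 2)) =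
      ∫ s in a..b, (((n : ℝ) - 1) * ρ t s ^ (n - 2) -
        ρ t s ^ (n - 1) * (p t s / (1 + q t s ^ 2))) := by
    refine intervalIntegral.integral_congr fun s hs => ?_
    rw [uIcc_of_le hab.le] at hs
    have h1 := H.pos t ht' s hs
    have h2 := sqrt_pos (q t s)
    rw [← cast_sub_one_mul_pow hn h1.ne', ← sq_sqrt (q t s), Real.sqrt_sq h2.le]
    field_simp
  have e2 : totalCurv n a b (ρ t) (q t) = ∫ s in a..b, (((n : ℝ) - 1) * ρ t s ^ (n - 2) +
      ((n - 1 : ℕ) : ℝ) * ρ t s ^ (n - 1 - 1) * (q t s * Real.arctan (q t s))) := by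
    refine intervalIntegral.integral_congr fun s hs => ?_
    rw [Nat.cast_sub hn, Nat.cast_one, show n - 1 - 1 = n - 2 by omega]
    ring
  rw [e1, e2, intervalIntegral.integral_sub, intervalIntegral.integral_add, hbp, sub_neg_eq_add]
  all_goals refine ContinuousOn.intervalIntegrable_of_Icc hab.le ?_
  all_goals fun_prop (disch := assumption)

/-- The mean value of the normal speed vanishes. -/
lemma integral_pow_mul_speed (H : IsRadialFlow n a b T ρ q p m ρt qt h) (hab : a < b)
    {t : ℝ} (ht : t ∈ Ioo 0 T) : ∫ s in a..b, ρ t s ^ (n - 1) * ρt t s = 0 := by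
  have ht' : t ∈ Ico 0 T := ⟨ht.1.le, ht.2⟩
  have hρ := H.continuousOn_ρ ht'
  have hq := H.continuousOn_q ht'
  have hp := H.continuousOn_p ht
  have hA : 0 < area n a b (ρ t) (q t) := area_pos hab hρ hq (H.pos t ht')
  have havg := H.avg t ht
  rw [← area, eq_div_iff hA.ne'] at havg
  have n1 : ∀ s ∈ Icc a b, ρ t s * √(1 + q t s ^ 2) ≠ 0 := fun s hs =>
    (mul_pos (H.pos t ht' s hs) (sqrt_pos _)).ne'
  have n2 : ∀ s ∈ Icc a b, √(1 + q t s ^ 2) ^ 3 ≠ 0 := fun s hs =>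
    (pow_pos (sqrt_pos _) 3).ne'
  have e : ∫ s in a..b, ρ t s ^ (n - 1) * ρt t s = ∫ s in a..b,
      (h t * (ρ t s ^ (n - 1) * √(1 + q t s ^ 2)) - (((n : ℝ) - 1) / (ρ t s * √(1 + q t s ^ 2)) -
      p t s / √(1 + q t s ^ 2) ^ 3) * (ρ t s ^ (n - 1) * √(1 + q t s ^ 2))) := by
    refine intervalIntegral.integral_congr fun s hs => ?_
    rw [uIcc_of_le hab.le] at hs
    rw [H.evolution t ht s hs]
    ring
  rw [e, intervalIntegral.integral_sub, ← havg, intervalIntegral.integral_const_mul, area, sub_self]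
  all_goals refine ContinuousOn.intervalIntegrable_of_Icc hab.le ?_
  all_goals fun_prop (disch := assumption)

lemma hasDerivAt_integral_pow (H : IsRadialFlow n a b T ρ q p m ρt qt h) (hab : a < b)
    {t : ℝ} (ht : t ∈ Ioo 0 T) (k : ℕ) :
    HasDerivAt (fun τ => ∫ s in a..b, ρ τ s ^ k) (k * ∫ s in a..b, ρ t s ^ (k - 1) * ρt t s) t := by
  have hsub : Ioo 0 T ×ˢ Icc a b ⊆ Ico 0 T ×ˢ Icc a b := prod_mono Ioo_subset_Ico_self subset_rfl
  have h1 := H.cont.mono hsub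
  have h2 := H.cont_ρt
  rw [← intervalIntegral.integral_const_mul]
  refine hasDerivAt_intervalIntegral (f := fun τ s => ρ τ s ^ k)
    (ft := fun t s => k * (ρ t s ^ (k - 1) * ρt t s)) hab
    (fun τ hτ => (H.continuousOn_ρ ⟨hτ.1.le, hτ.2⟩).pow k) (by fun_prop) (fun τ hτ s hs => ?_) ht
  refine ((H.time τ hτ s hs).pow k).congr_deriv (by ring)

lemma continuousOn_integral_pow (H : IsRadialFlow n a b T ρ q p m ρt qt h) (hab : a < b) (k : ℕ) :
    ContinuousOn (fun τ => ∫ s in a..b, ρ τ s ^ k) (Ico 0 T) :=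
  continuousOn_intervalIntegral hab (f := fun τ s => ρ τ s ^ k) (H.cont.pow k)

/-- The enclosed volume is preserved. -/
lemma volume_eq (H : IsRadialFlow n a b T ρ q p m ρt qt h) (hab : a < b)
    {t : ℝ} (ht : t ∈ Ico 0 T) : ∫ s in a..b, ρ t s ^ n = ∫ s in a..b, ρ 0 s ^ n := by
  have hd : ∀ τ ∈ Ioo 0 T, HasDerivAt (fun τ => ∫ s in a..b, ρ τ s ^ n) 0 τ := fun τ hτ => by
    have := H.hasDerivAt_integral_pow hab hτ n
    rwa [H.integral_pow_mul_speed hab hτ, mul_zero] at this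
  have hc := H.continuousOn_integral_pow hab n
  rcases ht.1.eq_or_lt with rfl | h0
  · rfl
  obtain ⟨ξ, hξ, he⟩ := exists_hasDerivAt_eq_slope _ (fun _ => (0 : ℝ)) h0
    (hc.mono fun τ hτ => ⟨hτ.1, hτ.2.trans_lt ht.2⟩)
    (fun τ hτ => hd τ ⟨hτ.1, hτ.2.trans ht.2⟩)
  rw [eq_comm, div_eq_zero_iff] at he
  rcases he with he | he <;> linarith

/-- First variation of area: the derivative is `-∫ H (H - h)`, and this equals `-∫ (H - h)²` because
`H - h` has mean zero. -/
lemma hasDerivAt_area (H : IsRadialFlow n a b T ρ q p m ρt qt h) (hn : 1 ≤ n) (hab : a < b)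
    {t : ℝ} (ht : t ∈ Ioo 0 T) :
    HasDerivAt (fun τ => area n a b (ρ τ) (q τ))
      (-∫ s in a..b, (((n : ℝ) - 1) / (ρ t s * √(1 + q t s ^ 2)) - p t s / √(1 + q t s ^ 2) ^ 3 -
        h t) ^ 2 * (ρ t s ^ (n - 1) * √(1 + q t s ^ 2))) t := by
  have ht' : t ∈ Ico 0 T := ⟨ht.1.le, ht.2⟩
  have hsub : Ioo 0 T ×ˢ Icc a b ⊆ Ico 0 T ×ˢ Icc a b := prod_mono Ioo_subset_Ico_self subset_rfl
  have j1 := H.cont.mono hsub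
  have j2 := H.cont_ρt
  have j3 := H.cont_q.mono hsub
  have j4 := H.cont_qt
  have hnv : ∀ z ∈ Ioo 0 T ×ˢ Icc a b, √(1 + q z.1 z.2 ^ 2) ≠ 0 := fun z _ => (sqrt_pos _).ne'
  have hd : HasDerivAt (fun τ => area n a b (ρ τ) (q τ))
      (∫ s in a..b, (((n : ℝ) - 1) * ρ t s ^ (n - 2) * ρt t s * √(1 + q t s ^ 2) +
        ρ t s ^ (n - 1) * (q t s * qt t s / √(1 + q t s ^ 2)))) t := by
    refine hasDerivAt_intervalIntegral (f := fun t s => ρ t s ^ (n - 1) * √(1 + q t s ^ 2))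
      (ft := fun t s => ((n : ℝ) - 1) * ρ t s ^ (n - 2) * ρt t s * √(1 + q t s ^ 2) +
        ρ t s ^ (n - 1) * (q t s * qt t s / √(1 + q t s ^ 2))) hab (fun τ hτ => ?_) ?_ ?_ ht
    · have := H.continuousOn_ρ (t := τ) ⟨hτ.1.le, hτ.2⟩
      have := H.continuousOn_q (t := τ) ⟨hτ.1.le, hτ.2⟩
      fun_prop
    · fun_prop (disch := assumption)
    · intro τ hτ s hs
      have h1 := (H.time τ hτ s hs).pow (n - 1)
      have h2 := (((H.time_q τ hτ s hs).pow 2).const_add 1).sqrt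
        (by positivity : 1 + q τ s ^ 2 ≠ 0)
      refine (h1.mul h2).congr_deriv ?_
      have := (sqrt_pos (q τ s)).ne'
      simp only [Pi.pow_apply, Nat.cast_sub hn, Nat.cast_one, show n - 1 - 1 = n - 2 by omega]
      field_simp
      simp
      ring
  refine hd.congr_deriv ?_
  have hρ := H.continuousOn_ρ ht'
  have hq := H.continuousOn_q ht'
  have hp := H.continuousOn_p ht
  have hρt := H.continuousOn_ρt ht
  have hqt := H.continuousOn_qt ht
  have n0 : ∀ s ∈ Icc a b, √(1 + q t s ^ 2) ≠ 0 := fun s hs => (sqrt_pos _).ne'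
  have n1 : ∀ s ∈ Icc a b, ρ t s * √(1 + q t s ^ 2) ≠ 0 := fun s hs =>
    (mul_pos (H.pos t ht' s hs) (sqrt_pos _)).ne'
  have n2 : ∀ s ∈ Icc a b, √(1 + q t s ^ 2) ^ 3 ≠ 0 := fun s hs =>
    (pow_pos (sqrt_pos _) 3).ne'
  have hbp := integral_eq_sub_of_hasDerivWithinAt_Icc hab
    (f := fun s => ρ t s ^ (n - 1) * (q t s / √(1 + q t s ^ 2)) * ρt t s)
    (f' := fun s => (((n : ℝ) - 1) * ρ t s ^ (n - 2) * q t s * (q t s / √(1 + q t s ^ 2)) +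
      ρ t s ^ (n - 1) * (p t s / √(1 + q t s ^ 2) ^ 3)) * ρt t s +
      ρ t s ^ (n - 1) * (q t s / √(1 + q t s ^ 2)) * qt t s) (fun s hs => by
      have h1 := (H.space t ht s hs).pow (n - 1)
      have h2 := (((H.space_q t ht s hs).pow 2).const_add 1).sqrt
        (by positivity : 1 + q t s ^ 2 ≠ 0)
      have h3 := (H.space_q t ht s hs).div h2 (n0 s hs)
      refine ((h1.mul h3).mul (H.space_ρt t ht s hs)).congr_deriv ?_
      have hv := n0 s hs
      have hv2 := sq_sqrt (q t s)
      simp only [Pi.pow_apply, Pi.mul_apply, Pi.div_apply, Nat.cast_sub hn, Nat.cast_one,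
        show n - 1 - 1 = n - 2 by omega]
      have e : (p t s * √(1 + q t s ^ 2) - q t s * ((2 : ℕ) * q t s ^ (2 - 1) * p t s /
          (2 * √(1 + q t s ^ 2)))) / √(1 + q t s ^ 2) ^ 2 = p t s / √(1 + q t s ^ 2) ^ 3 := by
        have : √(1 + q t s ^ 2) * √(1 + q t s ^ 2) = 1 + q t s ^ 2 := by rw [← sq, hv2]
        simp
        field_simp
        rw [hv2]
        ring
      rw [e]) (by fun_prop (disch := assumption))
  rw [H.neumann_left t ht, H.neumann_right t ht] at hbp
  simp only [zero_div, mul_zero, zero_mul, sub_zero] at hbp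
  have hsp := H.integral_pow_mul_speed hab ht
  -- The integrand is split into an exact `s`-derivative with vanishing boundary values, `h` times
  -- the mean-zero speed, and `-(H - h)²`.
  have e : ∫ s in a..b, (((n : ℝ) - 1) * ρ t s ^ (n - 2) * ρt t s * √(1 + q t s ^ 2) +
        ρ t s ^ (n - 1) * (q t s * qt t s / √(1 + q t s ^ 2))) =
      ∫ s in a..b, (((((n : ℝ) - 1) * ρ t s ^ (n - 2) * q t s * (q t s / √(1 + q t s ^ 2)) +
        ρ t s ^ (n - 1) * (p t s / √(1 + q t s ^ 2) ^ 3)) * ρt t s +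
        ρ t s ^ (n - 1) * (q t s / √(1 + q t s ^ 2)) * qt t s) +
        h t * (ρ t s ^ (n - 1) * ρt t s) -
        (((n : ℝ) - 1) / (ρ t s * √(1 + q t s ^ 2)) - p t s / √(1 + q t s ^ 2) ^ 3 -
          h t) ^ 2 * (ρ t s ^ (n - 1) * √(1 + q t s ^ 2))) := by
    refine intervalIntegral.integral_congr fun s hs => ?_
    rw [uIcc_of_le hab.le] at hs
    have h1 := H.pos t ht' s hs
    have hv := sqrt_pos (q t s)
    have hv2 := sq_sqrt (q t s)
    have hev := H.evolution t ht s hs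
    have hq2 : q t s ^ 2 = √(1 + q t s ^ 2) ^ 2 - 1 := by linarith
    generalize √(1 + q t s ^ 2) = v at *
    rw [← cast_sub_one_mul_pow hn h1.ne']
    have k1 : ∀ x : ℝ, x * q t s * (q t s / v) = x * (v - 1 / v) := fun x => by
      field_simp
      rw [hq2]
    rw [k1]
    have k2 : ((n : ℝ) - 1) / (ρ t s * v) = ((n : ℝ) - 1) / ρ t s * (1 / v) := by
      field_simp
    rw [k2] at hev ⊢
    generalize ((n : ℝ) - 1) / ρ t s = N at *
    generalize p t s / v ^ 3 = P at *
    generalize 1 / v = V at *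
    rw [hev]
    ring
  rw [e, intervalIntegral.integral_sub, intervalIntegral.integral_add, hbp,
    intervalIntegral.integral_const_mul, hsp, mul_zero, add_zero, zero_sub]
  all_goals refine ContinuousOn.intervalIntegrable_of_Icc hab.le ?_
  all_goals fun_prop (disch := assumption)

lemma continuousOn_area (H : IsRadialFlow n a b T ρ q p m ρt qt h) (hab : a < b) :
    ContinuousOn (fun τ => area n a b (ρ τ) (q τ)) (Ico 0 T) := by
  have h1 := H.cont
  have h2 := H.cont_q
  refine continuousOn_intervalIntegral hab
    (f := fun t s => ρ t s ^ (n - 1) * √(1 + q t s ^ 2)) ?_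
  fun_prop

/-- The area does not increase. -/
lemma area_le (H : IsRadialFlow n a b T ρ q p m ρt qt h) (hn : 1 ≤ n) (hab : a < b)
    {t : ℝ} (ht : t ∈ Ico 0 T) : area n a b (ρ t) (q t) ≤ area n a b (ρ 0) (q 0) := by
  have hanti : AntitoneOn (fun τ => area n a b (ρ τ) (q τ)) (Ico 0 T) := by
    refine antitoneOn_of_deriv_nonpos (convex_Ico 0 T) (H.continuousOn_area hab) ?_ ?_
    · rw [interior_Ico]
      exact fun τ hτ => (H.hasDerivAt_area hn hab hτ).differentiableAt.differentiableWithinAt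
    · rw [interior_Ico]
      intro τ hτ
      rw [(H.hasDerivAt_area hn hab hτ).deriv, neg_nonpos]
      refine intervalIntegral.integral_nonneg hab.le fun s hs => ?_
      have := H.pos τ ⟨hτ.1.le, hτ.2⟩ s hs
      positivity
  exact hanti ⟨le_rfl, ht.1.trans_lt ht.2⟩ ht ht.1

/-- The minimum of `ρⁿ` is at most its mean, which the volume fixes; its oscillation is at most `∫ n
ρⁿ⁻¹ |q|`, hence at most `n` times the area. -/
lemma pow_le (H : IsRadialFlow n a b T ρ q p m ρt qt h) (hn : 1 ≤ n) (hab : a < b)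
    {t s : ℝ} (ht : t ∈ Ioo 0 T) (hs : s ∈ Icc a b) :
    ρ t s ^ n ≤ (∫ s in a..b, ρ 0 s ^ n) / (b - a) + n * area n a b (ρ 0) (q 0) := by
  have ht' : t ∈ Ico 0 T := ⟨ht.1.le, ht.2⟩
  have hρ := H.continuousOn_ρ ht'
  have hq := H.continuousOn_q ht'
  obtain ⟨u, hu, hmin⟩ := isCompact_Icc.exists_isMinOn (nonempty_Icc.2 hab.le) (hρ.pow n)
  have h1 : ρ t u ^ n ≤ (∫ s in a..b, ρ 0 s ^ n) / (b - a) := by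
    rw [le_div_iff₀ (by linarith), ← H.volume_eq hab ht']
    have : ∫ _ in a..b, ρ t u ^ n ≤ ∫ s in a..b, ρ t s ^ n := by
      refine intervalIntegral.integral_mono_on hab.le (by simp)
        ((hρ.pow n).intervalIntegrable_of_Icc hab.le) fun s hs => hmin hs
    simpa [mul_comm] using this
  have hsub : uIcc u s ⊆ Icc a b := uIcc_subset_Icc hu hs
  have h2 : ∫ σ in u..s, n * ρ t σ ^ (n - 1) * q t σ = ρ t s ^ n - ρ t u ^ n := by
    refine intervalIntegral.integral_eq_sub_of_hasDeriv_right ((hρ.pow n).mono hsub)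
      (fun σ hσ => ?_) ?_
    · have hσ' : σ ∈ Ioo a b := ⟨(le_min hu.1 hs.1).trans_lt hσ.1, hσ.2.trans_le (max_le hu.2 hs.2)⟩
      exact (((H.space t ht σ (Ioo_subset_Icc_self hσ')).hasDerivAt
        (Icc_mem_nhds hσ'.1 hσ'.2)).pow n).hasDerivWithinAt
    · refine ContinuousOn.intervalIntegrable (ContinuousOn.mono ?_ hsub)
      fun_prop
  have h3 : |∫ σ in u..s, n * ρ t σ ^ (n - 1) * q t σ| ≤
      ∫ σ in a..b, n * (ρ t σ ^ (n - 1) * √(1 + q t σ ^ 2)) := by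
    rw [intervalIntegral.integral_of_le hab.le, ← Real.norm_eq_abs]
    refine (intervalIntegral.norm_integral_le_integral_norm_uIoc).trans ?_
    have hu' : uIoc u s ⊆ Ioc a b := fun σ hσ =>
      ⟨(le_min hu.1 hs.1).trans_lt hσ.1, hσ.2.trans (max_le hu.2 hs.2)⟩
    have hint : IntegrableOn (fun σ => n * (ρ t σ ^ (n - 1) * √(1 + q t σ ^ 2))) (Ioc a b) :=
      (intervalIntegrable_iff_integrableOn_Ioc_of_le hab.le).1
        (ContinuousOn.intervalIntegrable_of_Icc hab.le (by fun_prop))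
    refine (setIntegral_mono_on ?_ (hint.mono_set hu') measurableSet_uIoc fun σ hσ => ?_).trans
      (setIntegral_mono_set hint ?_ hu'.eventuallyLE)
    · exact ((intervalIntegrable_iff_integrableOn_Ioc_of_le hab.le).1
        (ContinuousOn.intervalIntegrable_of_Icc hab.le (by fun_prop))).mono_set hu'
    · have hpos := H.pos t ht' σ (Ioc_subset_Icc_self (hu' hσ))
      rw [Real.norm_eq_abs, abs_mul, abs_of_nonneg (by positivity), mul_assoc]
      gcongr
      exact abs_le_sqrt _
    · filter_upwards [ae_restrict_mem measurableSet_Ioc] with σ hσ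
      have hpos := H.pos t ht' σ (Ioc_subset_Icc_self hσ)
      simp only [Pi.zero_apply]
      positivity
  rw [intervalIntegral.integral_const_mul, h2] at h3
  have h4 := (le_abs_self _).trans h3
  have h5 := mul_le_mul_of_nonneg_left (H.area_le hn hab ht') (Nat.cast_nonneg (α := ℝ) n)
  rw [area] at h5
  linarith

end IsRadialFlow

/-! ### Control of the time integral of `h`. -/

namespace IsRadialFlow

variable {n : ℕ} {a b T : ℝ} {ρ q p m ρt qt : ℝ → ℝ → ℝ} {h : ℝ → ℝ}

lemma mul_arctan_nonneg (x : ℝ) : 0 ≤ x * Real.arctan x := by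
  rcases le_total 0 x with hx | hx
  · exact mul_nonneg hx (by simpa using hx)
  · exact mul_nonneg_of_nonpos_of_nonpos hx (by simpa using hx)

lemma mul_arctan_le (x : ℝ) : x * Real.arctan x ≤ 2 * √(1 + x ^ 2) := by
  have h1 : |Real.arctan x| ≤ 2 := by
    rw [abs_le]
    have := Real.neg_pi_div_two_lt_arctan x
    have := Real.arctan_lt_pi_div_two x
    have := Real.pi_lt_four
    constructor <;> linarith
  calc x * Real.arctan x ≤ |x| * |Real.arctan x| := by rw [← abs_mul]; exact le_abs_self _
    _ ≤ √(1 + x ^ 2) * 2 := by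
      exact mul_le_mul (abs_le_sqrt x) h1 (abs_nonneg _) (sqrt_pos x).le
    _ = _ := mul_comm _ _

lemma avg_nonneg (H : IsRadialFlow n a b T ρ q p m ρt qt h) (hn : 1 ≤ n) (hab : a < b)
    {t : ℝ} (ht : t ∈ Ioo 0 T) : 0 ≤ h t := by
  have ht' : t ∈ Ico 0 T := ⟨ht.1.le, ht.2⟩
  rw [H.avg_eq hn hab ht]
  refine div_nonneg (intervalIntegral.integral_nonneg hab.le fun s hs => ?_)
    (area_pos hab (H.continuousOn_ρ ht') (H.continuousOn_q ht') (H.pos t ht')).le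
  have h1 := H.pos t ht' s hs
  have h2 := mul_arctan_nonneg (q t s)
  have h3 : (1 : ℝ) ≤ n := by exact_mod_cast hn
  exact mul_nonneg (mul_nonneg (by linarith) (by positivity)) (by linarith)

/-- In the equation tested with `ρⁿ`, the `h` term is at least `h` times the volume, as `h ≥ 0`. Of
the loss `3 n A`, the share `2 n A` comes from `q arctan q ≤ 2 √(1 + q²)` and `n A` from the
rotational curvature. -/
lemma integral_pow_mul_speed_ge (H : IsRadialFlow n a b T ρ q p m ρt qt h) (hn : 1 ≤ n)
    (hab : a < b) {t : ℝ} (ht : t ∈ Ioo 0 T) :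
    h t * (∫ s in a..b, ρ 0 s ^ n) - 3 * n * area n a b (ρ 0) (q 0) ≤
      ∫ s in a..b, ρ t s ^ n * ρt t s := by
  have ht' : t ∈ Ico 0 T := ⟨ht.1.le, ht.2⟩
  have hρ := H.continuousOn_ρ ht'
  have hq := H.continuousOn_q ht'
  have hp := H.continuousOn_p ht
  have hne : ∀ s ∈ Icc a b, 1 + q t s ^ 2 ≠ 0 := fun s _ => by positivity
  have hat : ContinuousOn (fun s => Real.arctan (q t s)) (Icc a b) :=
    Real.continuous_arctan.comp_continuousOn hq
  have hn' : (1 : ℝ) ≤ n := by exact_mod_cast hn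
  have e1 : ∫ s in a..b, ρ t s ^ n * ρt t s = ∫ s in a..b,
      (ρ t s ^ n * (p t s / (1 + q t s ^ 2)) +
        (-(((n : ℝ) - 1) * ρ t s ^ (n - 1)) + h t * (ρ t s ^ n * √(1 + q t s ^ 2)))) := by
    refine intervalIntegral.integral_congr fun s hs => ?_
    rw [uIcc_of_le hab.le] at hs
    have h1 := H.pos t ht' s hs
    rw [H.evolution' ht hs]
    have : ρ t s ^ n = ρ t s ^ (n - 1) * ρ t s := by
      rw [← pow_succ, Nat.sub_add_cancel hn]
    rw [this]
    field_simp
    ring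
  have e2 : h t * (∫ s in a..b, ρ t s ^ n) - 3 * n * area n a b (ρ t) (q t) =
      ∫ s in a..b, (h t * ρ t s ^ n - 3 * n * (ρ t s ^ (n - 1) * √(1 + q t s ^ 2))) := by
    rw [intervalIntegral.integral_sub, intervalIntegral.integral_const_mul,
      intervalIntegral.integral_const_mul, area]
    all_goals refine ContinuousOn.intervalIntegrable_of_Icc hab.le ?_
    all_goals fun_prop
  have h3 : h t * (∫ s in a..b, ρ 0 s ^ n) - 3 * n * area n a b (ρ 0) (q 0) ≤
      h t * (∫ s in a..b, ρ t s ^ n) - 3 * n * area n a b (ρ t) (q t) := by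
    rw [H.volume_eq hab ht']
    have := H.area_le hn hab ht'
    gcongr
  refine h3.trans ?_
  rw [e2, e1, intervalIntegral.integral_add, H.integral_pow_mul_deriv_arctan hab ht n,
    ← intervalIntegral.integral_neg, ← intervalIntegral.integral_add]
  · refine intervalIntegral.integral_mono_on hab.le ?_ ?_ fun s hs => ?_
    · exact ContinuousOn.intervalIntegrable_of_Icc hab.le (by fun_prop)
    · exact ContinuousOn.intervalIntegrable_of_Icc hab.le (by fun_prop)
    have h1 := H.pos t ht' s hs
    have hh := H.avg_nonneg hn hab ht
    have v1 := one_le_sqrt (q t s)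
    have k1 : h t * ρ t s ^ n ≤ h t * (ρ t s ^ n * √(1 + q t s ^ 2)) :=
      mul_le_mul_of_nonneg_left (le_mul_of_one_le_right (by positivity) v1) hh
    have k2 : n * ρ t s ^ (n - 1) * (q t s * Real.arctan (q t s)) ≤
        n * ρ t s ^ (n - 1) * (2 * √(1 + q t s ^ 2)) :=
      mul_le_mul_of_nonneg_left (mul_arctan_le _) (by positivity)
    have k3 : ((n : ℝ) - 1) * ρ t s ^ (n - 1) ≤ n * (ρ t s ^ (n - 1) * √(1 + q t s ^ 2)) :=
      mul_le_mul (by linarith) (le_mul_of_one_le_right (by positivity) v1) (by positivity)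
        (by positivity)
    linarith
  all_goals refine ContinuousOn.intervalIntegrable_of_Icc hab.le ?_
  all_goals fun_prop (disch := assumption)

/-- A bounded function of time that grows at least at the rate `h`. -/
lemma exists_barrier (H : IsRadialFlow n a b T ρ q p m ρt qt h) (hn : 1 ≤ n) (hab : a < b)
    (hT : 0 < T) : ∃ (G G' : ℝ → ℝ) (K : ℝ), ContinuousOn G (Ico 0 T) ∧
      (∀ t ∈ Ioo 0 T, HasDerivAt G (G' t) t ∧ h t ≤ G' t ∧ G t ≤ K) := by
  set A := area n a b (ρ 0) (q 0) with hA
  set V := ∫ s in a..b, ρ 0 s ^ n with hV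
  have h0 : (0 : ℝ) ∈ Ico 0 T := ⟨le_rfl, hT⟩
  have hρ := H.continuousOn_ρ h0
  have hVpos : 0 < V := intervalIntegral.intervalIntegral_pos_of_pos_on
    (ContinuousOn.intervalIntegrable_of_Icc hab.le (by fun_prop))
    (fun s hs => pow_pos (H.pos 0 h0 s (Ioo_subset_Icc_self hs)) n) hab
  have hApos : 0 < A := area_pos hab hρ (H.continuousOn_q h0) (H.pos 0 h0)
  set B := V / (b - a) + n * A with hB
  have hBpos : 0 < B := add_pos_of_pos_of_nonneg (div_pos hVpos (by linarith)) (by positivity)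
  refine ⟨fun t => ((∫ s in a..b, ρ t s ^ (n + 1)) / (n + 1) + 3 * n * A * t) / V,
    fun t => ((∫ s in a..b, ρ t s ^ n * ρt t s) + 3 * n * A) / V,
    ((b - a) * (B * (1 + B)) + 3 * n * A * T) / V, ?_, fun t ht => ⟨?_, ?_, ?_⟩⟩
  · have := H.continuousOn_integral_pow hab (n + 1)
    fun_prop
  · have h1 := ((H.hasDerivAt_integral_pow hab ht (n + 1)).div_const ((n : ℝ) + 1)).add
      ((hasDerivAt_id t).const_mul (3 * n * A))
    refine (h1.div_const V).congr_deriv ?_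
    have : (n : ℝ) + 1 ≠ 0 := by positivity
    simp only [Nat.add_sub_cancel, Nat.cast_add, Nat.cast_one]
    field_simp
  · rw [le_div_iff₀ hVpos]
    have := H.integral_pow_mul_speed_ge hn hab ht
    linarith
  · have ht' : t ∈ Ico 0 T := ⟨ht.1.le, ht.2⟩
    have hρt := H.continuousOn_ρ ht'
    have h1 : ∫ s in a..b, ρ t s ^ (n + 1) ≤ ∫ _ in a..b, B * (1 + B) := by
      refine intervalIntegral.integral_mono_on hab.le
        (ContinuousOn.intervalIntegrable_of_Icc hab.le (by fun_prop)) (by simp) fun s hs => ?_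
      have hp := H.pos t ht' s hs
      have hle := H.pow_le hn hab ht hs
      -- Avoids `n`-th roots: where `ρ ≥ 1`, one has `ρ ≤ ρⁿ ≤ B`.
      have h2 : ρ t s ≤ 1 + B := by
        rcases le_total (ρ t s) 1 with h1 | h1
        · linarith
        · have := le_self_pow₀ h1 (by omega : n ≠ 0)
          linarith
      rw [pow_succ]
      exact mul_le_mul hle h2 hp.le hBpos.le
    rw [intervalIntegral.integral_const, smul_eq_mul] at h1
    have h3 : (∫ s in a..b, ρ t s ^ (n + 1)) / (n + 1) ≤ ∫ s in a..b, ρ t s ^ (n + 1) := by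
      refine div_le_self (intervalIntegral.integral_nonneg hab.le fun s hs => ?_) (by simp)
      have := H.pos t ht' s hs
      positivity
    have h4 : 3 * n * A * t ≤ 3 * n * A * T := mul_le_mul_of_nonneg_left ht.2.le (by positivity)
    simp only
    gcongr
    linarith

/-! ### The maximum principle for `v y`. -/

lemma hasDerivAt_gradient_height (H : IsRadialFlow n a b T ρ q p m ρt qt h) {t s : ℝ}
    (ht : t ∈ Ioo 0 T) (hs : s ∈ Icc a b) :
    HasDerivAt (fun τ => ρ τ s * √(1 + q τ s ^ 2))
      (ρt t s * √(1 + q t s ^ 2) + ρ t s * (q t s * qt t s / √(1 + q t s ^ 2))) t := by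
  have h2 := (((H.time_q t ht s hs).pow 2).const_add 1).sqrt
    (by positivity : 1 + q t s ^ 2 ≠ 0)
  refine ((H.time t ht s hs).mul h2).congr_deriv ?_
  have := (sqrt_pos (q t s)).ne'
  simp only [Pi.pow_apply, Nat.cast_ofNat, Nat.reduceSub, pow_one]
  field_simp

lemma hasDerivWithinAt_gradient_height (H : IsRadialFlow n a b T ρ q p m ρt qt h) {t s : ℝ}
    (ht : t ∈ Ioo 0 T) (hs : s ∈ Icc a b) :
    HasDerivWithinAt (fun σ => ρ t σ * √(1 + q t σ ^ 2))
      (q t s / √(1 + q t s ^ 2) * (1 + q t s ^ 2 + ρ t s * p t s)) (Icc a b) s := by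
  have h2 := (((H.space_q t ht s hs).pow 2).const_add 1).sqrt
    (by positivity : 1 + q t s ^ 2 ≠ 0)
  refine ((H.space t ht s hs).mul h2).congr_deriv ?_
  have := (sqrt_pos (q t s)).ne'
  simp
  field_simp
  rw [sq_sqrt]

lemma hasDerivWithinAt_deriv_gradient_height (H : IsRadialFlow n a b T ρ q p m ρt qt h) {t s : ℝ}
    (ht : t ∈ Ioo 0 T) (hs : s ∈ Icc a b) :
    HasDerivWithinAt (fun σ => q t σ / √(1 + q t σ ^ 2) * (1 + q t σ ^ 2 + ρ t σ * p t σ))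
      (p t s / √(1 + q t s ^ 2) ^ 3 * (1 + q t s ^ 2 + ρ t s * p t s) +
        q t s / √(1 + q t s ^ 2) * (3 * q t s * p t s + ρ t s * m t s)) (Icc a b) s := by
  have hv := (sqrt_pos (q t s)).ne'
  have h1 := ((H.space_q t ht s hs).pow 2).const_add 1
  have h2 := h1.sqrt (by positivity : 1 + q t s ^ 2 ≠ 0)
  have h3 := (H.space_q t ht s hs).div h2 hv
  refine (h3.mul (h1.add ((H.space t ht s hs).mul (H.space_p t ht s hs)))).congr_deriv ?_
  have hv2 := sq_sqrt (q t s)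
  have e : (p t s * √(1 + q t s ^ 2) - q t s * ((2 : ℕ) * q t s ^ (2 - 1) * p t s /
      (2 * √(1 + q t s ^ 2)))) / √(1 + q t s ^ 2) ^ 2 = p t s / √(1 + q t s ^ 2) ^ 3 := by
    simp
    field_simp
    rw [hv2]
    ring
  simp only [Pi.pow_apply, Pi.mul_apply, Pi.div_apply, Pi.add_apply] at *
  rw [e]
  simp only [Nat.cast_ofNat, Nat.reduceSub, pow_one]
  ring

/-- The evolution equation of the slope of the radius function. -/
lemma evolution_slope (H : IsRadialFlow n a b T ρ q p m ρt qt h) (hab : a < b) {t s : ℝ}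
    (ht : t ∈ Ioo 0 T) (hs : s ∈ Icc a b) :
    qt t s = m t s / (1 + q t s ^ 2) - 2 * p t s ^ 2 * q t s / (1 + q t s ^ 2) ^ 2 +
      ((n : ℝ) - 1) * q t s / ρ t s ^ 2 + h t * (q t s * p t s / √(1 + q t s ^ 2)) := by
  have hρ := (H.pos t ⟨ht.1.le, ht.2⟩ s hs).ne'
  have hne : 1 + q t s ^ 2 ≠ 0 := by positivity
  have h1 := ((H.space_q t ht s hs).pow 2).const_add 1
  have h2 := (h1.sqrt hne).const_mul (h t)
  have h3 := (H.space_p t ht s hs).div h1 hne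
  have h4 := (hasDerivWithinAt_const s (Icc a b) ((n : ℝ) - 1)).div (H.space t ht s hs) hρ
  have h5 := ((h3.sub h4).add h2).congr (f₁ := ρt t) (fun σ hσ => H.evolution' ht hσ)
    (H.evolution' ht hs)
  rw [(uniqueDiffOn_Icc hab s hs).eq_deriv _ (H.space_ρt t ht s hs) h5]
  have := (sqrt_pos (q t s)).ne'
  simp
  field_simp
  ring

/-- The differential inequality for `v y` at a critical point on a time slice. -/
lemma gradient_height_evolution_le (H : IsRadialFlow n a b T ρ q p m ρt qt h) (hn : 1 ≤ n)
    (hab : a < b) {t s : ℝ} (ht : t ∈ Ioo 0 T) (hs : s ∈ Icc a b)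
    (h1 : q t s / √(1 + q t s ^ 2) * (1 + q t s ^ 2 + ρ t s * p t s) = 0)
    (h2 : p t s / √(1 + q t s ^ 2) ^ 3 * (1 + q t s ^ 2 + ρ t s * p t s) +
        q t s / √(1 + q t s ^ 2) * (3 * q t s * p t s + ρ t s * m t s) ≤ 0) :
    ρt t s * √(1 + q t s ^ 2) + ρ t s * (q t s * qt t s / √(1 + q t s ^ 2)) ≤ h t := by
  have hρ := H.pos t ⟨ht.1.le, ht.2⟩ s hs
  have hv := sqrt_pos (q t s)
  have hv2 := sq_sqrt (q t s)
  have hn' : (1 : ℝ) ≤ n := by exact_mod_cast hn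
  rw [H.evolution_slope hab ht hs, H.evolution' ht hs]
  generalize ρ t s = r at *
  generalize q t s = x at *
  generalize p t s = y at *
  generalize m t s = z at *
  -- A critical point has `q = 0` or `ρ ∂ₛq = -(1 + q²)`. In the first case the second order
  -- condition is `y + r y² ≤ 0`, so `y ≤ 0`.
  rcases mul_eq_zero.1 h1 with h0 | h0
  · have hx : x = 0 := (div_eq_zero_iff.1 h0).resolve_right hv.ne'
    subst hx
    simp only [ne_eq, OfNat.ofNat_ne_zero, not_false_eq_true, zero_pow, add_zero, Real.sqrt_one,
      one_pow, div_one, zero_mul, mul_zero, mul_one] at h2 ⊢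
    have : 0 ≤ ((n : ℝ) - 1) / r := div_nonneg (by linarith) hρ.le
    nlinarith [mul_nonneg hρ.le (sq_nonneg y)]
  · rw [h0, mul_zero, zero_add] at h2
    have hy : y = -(1 + x ^ 2) / r := by
      field_simp
      linarith
    rw [← hv2] at hy ⊢
    generalize hvd : √(1 + x ^ 2) = v at *
    rw [Real.sqrt_sq hv.le]
    -- Substituting `r y = -v²`, the `h` terms become `h (v² - x²) = h`, the third derivative enters
    -- only through the second order condition, and the remainder is `-n / (r v)`.
    have e : (y / v ^ 2 - ((n : ℝ) - 1) / r + h t * v) * v + r * (x * (z / v ^ 2 -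
        2 * y ^ 2 * x / (v ^ 2) ^ 2 + ((n : ℝ) - 1) * x / r ^ 2 + h t * (x * y / v)) / v) =
        x / v * (3 * x * y + r * z) / v ^ 2 + h t - n / (r * v) := by
      rw [hy]
      have hx : x ^ 2 = v ^ 2 - 1 := by linarith
      field_simp
      ring_nf
      simp only [hx]
      ring
    rw [e]
    have k1 : x / v * (3 * x * y + r * z) / v ^ 2 ≤ 0 :=
      div_nonpos_of_nonpos_of_nonneg h2 (by positivity)
    have k2 : 0 ≤ (n : ℝ) / (r * v) := by positivity
    linarith

/-- The product of the gradient function and the height function is bounded on a finite time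
interval. -/
theorem exists_gradient_height_bound (H : IsRadialFlow n a b T ρ q p m ρt qt h) (hn : 1 ≤ n)
    (hab : a < b) (hT : 0 < T) :
    ∃ C, ∀ t ∈ Ico 0 T, ∀ s ∈ Icc a b, √(1 + q t s ^ 2) * ρ t s < C := by
  obtain ⟨G, G', K, hG, hG'⟩ := H.exists_barrier hn hab hT
  have h0 : (0 : ℝ) ∈ Ico 0 T := ⟨le_rfl, hT⟩
  have hw : ContinuousOn (fun z : ℝ × ℝ => ρ z.1 z.2 * √(1 + q z.1 z.2 ^ 2))
      (Ico 0 T ×ˢ Icc a b) := by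
    have h1 := H.cont
    have h2 := H.cont_q
    fun_prop
  obtain ⟨W, hW⟩ := isCompact_Icc.exists_bound_of_continuousOn
    (continuousOn_slice (f := fun t s => ρ t s * √(1 + q t s ^ 2)) hw h0)
  have hW0 : ∀ s ∈ Icc a b, ρ 0 s * √(1 + q 0 s ^ 2) ≤ W := fun s hs =>
    (le_abs_self _).trans (hW s hs)
  have main : ∀ t ∈ Ioo 0 T, ∀ s ∈ Icc a b, ρ t s * √(1 + q t s ^ 2) - G t ≤ W - G 0 := by
    by_contra! hcon
    obtain ⟨t₁, ht₁, s₁, hs₁, hlt⟩ := hcon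
    -- Subtracting `ε t` makes the differential inequality strict; `ε` uses up half of the excess at
    -- `(t₁, s₁)`.
    obtain ⟨ε, hε, hε'⟩ : ∃ ε > 0, W - G 0 < ρ t₁ s₁ * √(1 + q t₁ s₁ ^ 2) - G t₁ - ε * t₁ := by
      refine ⟨(ρ t₁ s₁ * √(1 + q t₁ s₁ ^ 2) - G t₁ - (W - G 0)) / (2 * t₁),
        div_pos (by linarith) (by linarith [ht₁.1]), ?_⟩
      have := ht₁.1.ne'
      have e : (ρ t₁ s₁ * √(1 + q t₁ s₁ ^ 2) - G t₁ - (W - G 0)) / (2 * t₁) * t₁ =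
        (ρ t₁ s₁ * √(1 + q t₁ s₁ ^ 2) - G t₁ - (W - G 0)) / 2 := by field_simp
      rw [e]
      linarith
    set Φ : ℝ × ℝ → ℝ := fun z => ρ z.1 z.2 * √(1 + q z.1 z.2 ^ 2) - G z.1 - ε * z.1 with hΦ
    have hsub : Icc 0 t₁ ⊆ Ico 0 T := fun τ hτ => ⟨hτ.1, hτ.2.trans_lt ht₁.2⟩
    have hΦc : ContinuousOn Φ (Icc 0 t₁ ×ˢ Icc a b) := by
      have h1 := hw.mono (prod_mono hsub (subset_refl (Icc a b)))
      have h2 : ContinuousOn (fun z : ℝ × ℝ => G z.1) (Icc 0 t₁ ×ˢ Icc a b) :=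
        hG.comp continuousOn_fst fun z hz => hsub hz.1
      exact (h1.sub h2).sub (by fun_prop)
    obtain ⟨⟨t, s⟩, ⟨ht, hs⟩, hmax⟩ := (isCompact_Icc.prod isCompact_Icc).exists_isMaxOn
      ⟨(t₁, s₁), ⟨⟨ht₁.1.le, le_rfl⟩, hs₁⟩⟩ hΦc
    have hle : Φ (t₁, s₁) ≤ Φ (t, s) := hmax ⟨⟨ht₁.1.le, le_rfl⟩, hs₁⟩
    simp only at ht hs
    have htpos : 0 < t := by
      rcases ht.1.eq_or_lt with h | h
      · exfalso
        subst h
        simp only [hΦ] at hle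
        linarith [hW0 s hs]
      · exact h
    have htT : t ∈ Ioo 0 T := ⟨htpos, (hsub ht).2⟩
    have hsmax : IsMaxOn (fun σ => ρ t σ * √(1 + q t σ ^ 2)) (Icc a b) s := fun σ hσ => by
      have : Φ (t, σ) ≤ Φ (t, s) := hmax ⟨ht, hσ⟩
      simp only [hΦ] at this
      simp only [mem_ofPred_eq]
      linarith
    -- The spatial derivative has the factor `q`, so the Neumann condition makes the end points
    -- critical as well.
    have hcrit : q t s / √(1 + q t s ^ 2) * (1 + q t s ^ 2 + ρ t s * p t s) = 0 := by
      rcases hs.1.eq_or_lt with h | h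
      · rw [← h, H.neumann_left t htT]; simp
      rcases hs.2.eq_or_lt with h' | h'
      · rw [h', H.neumann_right t htT]; simp
      exact deriv_eq_zero_of_isMaxOn ⟨h, h'⟩ (H.hasDerivWithinAt_gradient_height htT hs) hsmax
    have hsecond := second_deriv_nonpos_of_isMaxOn hab hs
      (fun σ hσ => H.hasDerivWithinAt_gradient_height htT hσ)
      (H.hasDerivWithinAt_deriv_gradient_height htT hs) hcrit hsmax
    have hineq := H.gradient_height_evolution_le hn hab htT hs hcrit hsecond
    obtain ⟨hGd, hGh, -⟩ := hG' t htT
    have htime := deriv_nonneg_of_forall_le_left htpos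
      (((H.hasDerivAt_gradient_height htT hs).sub hGd).sub ((hasDerivAt_id t).const_mul ε))
      (fun τ hτ => by
        have : Φ (τ, s) ≤ Φ (t, s) := hmax ⟨⟨hτ.1.le, hτ.2.le.trans ht.2⟩, hs⟩
        exact this)
    -- The contradiction is `0 ≤ ∂ₜ(v y) - G' - ε ≤ h - h - ε < 0`.
    linarith
  refine ⟨max W (W - G 0 + K) + 1, fun t ht s hs => ?_⟩
  rw [mul_comm]
  rcases ht.1.eq_or_lt with h | h
  · rw [← h]
    linarith [hW0 s hs, le_max_left W (W - G 0 + K)]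
  · have htT : t ∈ Ioo 0 T := ⟨h, ht.2⟩
    linarith [main t htT s hs, (hG' t htT).2.2, le_max_right W (W - G 0 + K)]

end IsRadialFlow

/-! ### Uniqueness of the flow by an energy estimate. -/

section Uniqueness

variable {a b : ℝ}

/-- A radius function `r` with slope `q` taking values in a fixed box. -/
structure IsBoxed (a b δ R M : ℝ) (r q : ℝ → ℝ) : Prop where
  cont : ContinuousOn r (Icc a b)
  cont_slope : ContinuousOn q (Icc a b)
  mem : ∀ s ∈ Icc a b, r s ∈ Icc δ R
  mem_slope : ∀ s ∈ Icc a b, q s ∈ Icc (-M) M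

/-- A `C¹` function is bounded and Lipschitz on the compact box of values. It is applied to the
integrands of the total curvature and of the area. -/
lemma exists_integral_lipschitz (hab : a < b) (δ R M : ℝ) {φ : ℝ × ℝ → ℝ} (hφ : ContDiff ℝ 1 φ) :
    ∃ L B : ℝ, 0 ≤ L ∧ 0 ≤ B ∧ (∀ r q, IsBoxed a b δ R M r q →
      |∫ s in a..b, φ (r s, q s)| ≤ B) ∧ ∀ r₁ q₁ r₂ q₂, IsBoxed a b δ R M r₁ q₁ →
      IsBoxed a b δ R M r₂ q₂ → |(∫ s in a..b, φ (r₁ s, q₁ s)) - ∫ s in a..b, φ (r₂ s, q₂ s)| ≤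
        L * ∫ s in a..b, (|r₁ s - r₂ s| + |q₁ s - q₂ s|) := by
  have hK : IsCompact (Icc δ R ×ˢ Icc (-M) M) := isCompact_Icc.prod isCompact_Icc
  obtain ⟨L, hL⟩ := (hφ.locallyLipschitz.locallyLipschitzOn).exists_lipschitzOnWith_of_compact hK
  obtain ⟨B, hB⟩ := hK.exists_bound_of_continuousOn hφ.continuous.continuousOn
  have hmem : ∀ {r q}, IsBoxed a b δ R M r q → ∀ s ∈ Icc a b,
      (r s, q s) ∈ Icc δ R ×ˢ Icc (-M) M := fun h s hs => ⟨h.mem s hs, h.mem_slope s hs⟩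
  have hc : ∀ {r q}, IsBoxed a b δ R M r q → IntervalIntegrable (fun s => φ (r s, q s)) volume a b :=
    fun h => (hφ.continuous.comp_continuousOn (h.cont.prodMk h.cont_slope)).intervalIntegrable_of_Icc
      hab.le
  refine ⟨L, |B| * (b - a), L.2, mul_nonneg (abs_nonneg _) (by linarith), fun r q h => ?_,
    fun r₁ q₁ r₂ q₂ h₁ h₂ => ?_⟩
  · have := intervalIntegral.norm_integral_le_of_norm_le_const (a := a) (b := b) (C := |B|)
      (f := fun s => φ (r s, q s)) (fun s hs => by
        rw [uIoc_of_le hab.le] at hs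
        exact (hB _ (hmem h s (Ioc_subset_Icc_self hs))).trans (le_abs_self _))
    rwa [abs_of_pos (by linarith : 0 < b - a)] at this
  · rw [← intervalIntegral.integral_sub (hc h₁) (hc h₂), ← intervalIntegral.integral_const_mul]
    refine (intervalIntegral.abs_integral_le_integral_abs hab.le).trans ?_
    have c1 := h₁.cont
    have c2 := h₂.cont
    have c3 := h₁.cont_slope
    have c4 := h₂.cont_slope
    refine intervalIntegral.integral_mono_on hab.le ((hc h₁).sub (hc h₂)).abs
      (ContinuousOn.intervalIntegrable_of_Icc hab.le (by fun_prop)) fun s hs => ?_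
    have := hL.dist_le_mul _ (hmem h₁ s hs) _ (hmem h₂ s hs)
    rw [Real.dist_eq] at this
    refine this.trans (mul_le_mul_of_nonneg_left ?_ L.2)
    rw [Prod.dist_eq, Real.dist_eq, Real.dist_eq]
    exact max_le_add_of_nonneg (abs_nonneg _) (abs_nonneg _)

open IsRadialFlow in
/-- The average of the mean curvature is bounded and Lipschitz continuous in `C¹`. -/
lemma exists_avg_lipschitz (n : ℕ) (hab : a < b) {δ : ℝ} (hδ : 0 < δ) (R M : ℝ) :
    ∃ L B : ℝ, 0 ≤ L ∧ 0 ≤ B ∧ (∀ r q, IsBoxed a b δ R M r q →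
      |totalCurv n a b r q / area n a b r q| ≤ B) ∧ ∀ r₁ q₁ r₂ q₂, IsBoxed a b δ R M r₁ q₁ →
      IsBoxed a b δ R M r₂ q₂ → |totalCurv n a b r₁ q₁ / area n a b r₁ q₁ -
        totalCurv n a b r₂ q₂ / area n a b r₂ q₂| ≤
        L * ∫ s in a..b, (|r₁ s - r₂ s| + |q₁ s - q₂ s|) := by
  have hφ : ContDiff ℝ 1 fun z : ℝ × ℝ => ((n : ℝ) - 1) * z.1 ^ (n - 2) *
      (1 + z.2 * Real.arctan z.2) := by
    have := Real.contDiff_arctan (n := 1)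
    fun_prop
  have hψ : ContDiff ℝ 1 fun z : ℝ × ℝ => z.1 ^ (n - 1) * √(1 + z.2 ^ 2) := by
    refine ContDiff.mul (by fun_prop) (ContDiff.sqrt (by fun_prop)
      fun z => (by positivity : 1 + z.2 ^ 2 ≠ 0))
  obtain ⟨L₁, B₁, hL₁, hB₁, h₁, h₁'⟩ := exists_integral_lipschitz hab δ R M hφ
  obtain ⟨L₂, B₂, hL₂, hB₂, h₂, h₂'⟩ := exists_integral_lipschitz hab δ R M hψ
  -- A lower bound for the area throughout the box, which keeps the quotient Lipschitz.
  set A := (b - a) * δ ^ (n - 1) with hA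
  have hApos : 0 < A := mul_pos (by linarith) (by positivity)
  have hAle : ∀ r q, IsBoxed a b δ R M r q → A ≤ area n a b r q := fun r q h => by
    have c1 := h.cont
    have c2 := h.cont_slope
    have : ∫ _ in a..b, δ ^ (n - 1) ≤ area n a b r q := by
      refine intervalIntegral.integral_mono_on hab.le (by simp)
        (ContinuousOn.intervalIntegrable_of_Icc hab.le (by fun_prop)) fun s hs => ?_
      have h1 := (h.mem s hs).1
      have h2 : δ ^ (n - 1) ≤ r s ^ (n - 1) := pow_le_pow_left₀ hδ.le h1 _
      exact h2.trans (le_mul_of_one_le_right ((by positivity : (0 : ℝ) ≤ δ ^ (n - 1)).trans h2) (one_le_sqrt _))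
    simpa [hA] using this
  refine ⟨L₁ / A + B₁ * L₂ / (A * A), B₁ / A, by positivity, by positivity, fun r q h => ?_,
    fun r₁ q₁ r₂ q₂ b₁ b₂ => ?_⟩
  · rw [abs_div, abs_of_pos (hApos.trans_le (hAle r q h))]
    exact div_le_div₀ hB₁ (h₁ r q h) hApos (hAle r q h)
  · have a1 := hAle r₁ q₁ b₁
    have a2 := hAle r₂ q₂ b₂
    have p1 := hApos.trans_le a1
    have p2 := hApos.trans_le a2
    have k1 : |totalCurv n a b r₁ q₁ - totalCurv n a b r₂ q₂| ≤ _ := h₁' r₁ q₁ r₂ q₂ b₁ b₂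
    have k2 : |area n a b r₁ q₁ - area n a b r₂ q₂| ≤ _ := h₂' r₁ q₁ r₂ q₂ b₁ b₂
    have k3 : |totalCurv n a b r₂ q₂| ≤ _ := h₁ r₂ q₂ b₂
    have hJ : 0 ≤ ∫ s in a..b, (|r₁ s - r₂ s| + |q₁ s - q₂ s|) :=
      intervalIntegral.integral_nonneg hab.le fun s _ => by positivity
    have e : totalCurv n a b r₁ q₁ / area n a b r₁ q₁ - totalCurv n a b r₂ q₂ / area n a b r₂ q₂ =
        (totalCurv n a b r₁ q₁ - totalCurv n a b r₂ q₂) / area n a b r₁ q₁ -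
        totalCurv n a b r₂ q₂ * (area n a b r₁ q₁ - area n a b r₂ q₂) /
          (area n a b r₁ q₁ * area n a b r₂ q₂) := by
      field_simp
      ring
    rw [e]
    generalize (∫ s in a..b, (|r₁ s - r₂ s| + |q₁ s - q₂ s|)) = J at *
    refine (abs_sub _ _).trans ?_
    rw [abs_div, abs_div, abs_mul, abs_of_pos p1, abs_of_pos (mul_pos p1 p2), add_mul]
    refine add_le_add ?_ ?_
    · rw [div_mul_eq_mul_div]
      exact div_le_div₀ (by positivity) k1 hApos a1
    · rw [div_mul_eq_mul_div, mul_assoc B₁]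
      exact div_le_div₀ (by positivity) (mul_le_mul k3 k2 (abs_nonneg _) hB₁) (by positivity)
        (mul_le_mul a1 a2 hApos.le p1.le)

/-- The derivative of `arctan` is at least `1 / (1 + M²)` on `[-M, M]`. This is the ellipticity of
the equation for bounded slopes. -/
lemma mul_sub_arctan_ge {M x y : ℝ} (hx : x ∈ Icc (-M) M) (hy : y ∈ Icc (-M) M) :
    (1 + M ^ 2)⁻¹ * (x - y) ^ 2 ≤ (x - y) * (Real.arctan x - Real.arctan y) := by
  have key : ∀ {x y : ℝ}, x ∈ Icc (-M) M → y ∈ Icc (-M) M → x < y →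
      (1 + M ^ 2)⁻¹ * (y - x) ≤ Real.arctan y - Real.arctan x := by
    intro x y hx hy hxy
    obtain ⟨ξ, hξ, he⟩ := exists_hasDerivAt_eq_slope Real.arctan (fun x => 1 / (1 + x ^ 2)) hxy
      Real.continuous_arctan.continuousOn (fun z _ => Real.hasDerivAt_arctan z)
    have h1 : ξ ^ 2 ≤ M ^ 2 := sq_le_sq' (by linarith [hx.1, hξ.1]) (by linarith [hy.2, hξ.2])
    rw [eq_div_iff (by linarith)] at he
    rw [← he, ← one_div]
    have : 0 ≤ y - x := by linarith
    gcongr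
  rcases lt_trichotomy x y with h | h | h
  · nlinarith [key hx hy h]
  · simp [h]
  · nlinarith [key hy hx h]

lemma abs_sqrt_sub_sqrt_le (x y : ℝ) : |√(1 + x ^ 2) - √(1 + y ^ 2)| ≤ |x - y| := by
  have hx := IsRadialFlow.sqrt_pos x
  have hy := IsRadialFlow.sqrt_pos y
  have hx2 := IsRadialFlow.sq_sqrt x
  have hy2 := IsRadialFlow.sq_sqrt y
  have h1 := IsRadialFlow.abs_le_sqrt x
  have h2 := IsRadialFlow.abs_le_sqrt y
  have e : (√(1 + x ^ 2) - √(1 + y ^ 2)) * (√(1 + x ^ 2) + √(1 + y ^ 2)) = (x - y) * (x + y) := by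
    linarith
  have e' := congrArg abs e
  rw [abs_mul, abs_mul, abs_of_pos (add_pos hx hy)] at e'
  have h3 : |x + y| ≤ √(1 + x ^ 2) + √(1 + y ^ 2) := (abs_add_le x y).trans (add_le_add h1 h2)
  have h4 : |x - y| * |x + y| ≤ |x - y| * (√(1 + x ^ 2) + √(1 + y ^ 2)) :=
    mul_le_mul_of_nonneg_left h3 (abs_nonneg _)
  rw [← e'] at h4
  exact le_of_mul_le_mul_right h4 (add_pos hx hy)

/-- Cauchy-Schwarz against the constant `1`, from the nonnegative variance of `|f|`. -/
lemma sq_integral_abs_le (hab : a < b) {f : ℝ → ℝ} (hf : ContinuousOn f (Icc a b)) :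
    (∫ s in a..b, |f s|) ^ 2 ≤ (b - a) * ∫ s in a..b, f s ^ 2 := by
  set X := ∫ s in a..b, |f s| with hX
  have hl : 0 < b - a := by linarith
  have h : 0 ≤ ∫ s in a..b, ((b - a) * |f s| - X) ^ 2 :=
    intervalIntegral.integral_nonneg hab.le fun s _ => sq_nonneg _
  have e : ∫ s in a..b, ((b - a) * |f s| - X) ^ 2 =
      ∫ s in a..b, ((b - a) ^ 2 * f s ^ 2 - 2 * (b - a) * X * |f s| + X ^ 2) := by
    refine intervalIntegral.integral_congr fun s _ => ?_
    rw [← sq_abs (f s)]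
    ring
  rw [e, intervalIntegral.integral_add, intervalIntegral.integral_sub,
    intervalIntegral.integral_const_mul, intervalIntegral.integral_const_mul,
    intervalIntegral.integral_const, ← hX, smul_eq_mul] at h
  · have : 0 ≤ (b - a) * ((b - a) * (∫ s in a..b, f s ^ 2) - X ^ 2) := by linarith
    linarith [nonneg_of_mul_nonneg_right this hl]
  all_goals refine ContinuousOn.intervalIntegrable_of_Icc hab.le ?_
  all_goals fun_prop

namespace IsRadialFlow

variable {n : ℕ} {T : ℝ} {ρ₁ q₁ p₁ m₁ ρt₁ qt₁ : ℝ → ℝ → ℝ} {h₁ : ℝ → ℝ}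
  {ρ₂ q₂ p₂ m₂ ρt₂ qt₂ : ℝ → ℝ → ℝ} {h₂ : ℝ → ℝ}

lemma mono {ρ q p m ρt qt : ℝ → ℝ → ℝ} {h : ℝ → ℝ}
    (H : IsRadialFlow n a b T ρ q p m ρt qt h) {T' : ℝ} (hT : T' ≤ T) :
    IsRadialFlow n a b T' ρ q p m ρt qt h := by
  have h1 : Ico 0 T' ⊆ Ico 0 T := Ico_subset_Ico_right hT
  have h2 : Ioo 0 T' ⊆ Ioo 0 T := Ioo_subset_Ioo_right hT
  have h3 : Ico 0 T' ×ˢ Icc a b ⊆ Ico 0 T ×ˢ Icc a b := prod_mono h1 subset_rfl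
  have h4 : Ioo 0 T' ×ˢ Icc a b ⊆ Ioo 0 T ×ˢ Icc a b := prod_mono h2 subset_rfl
  exact
  { pos := fun t ht => H.pos t (h1 ht)
    cont := H.cont.mono h3
    cont_q := H.cont_q.mono h3
    cont_p := H.cont_p.mono h4
    cont_ρt := H.cont_ρt.mono h4
    cont_qt := H.cont_qt.mono h4
    space := fun t ht => H.space t (h2 ht)
    space_q := fun t ht => H.space_q t (h2 ht)
    space_p := fun t ht => H.space_p t (h2 ht)
    space_ρt := fun t ht => H.space_ρt t (h2 ht)
    time := fun t ht => H.time t (h2 ht)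
    time_q := fun t ht => H.time_q t (h2 ht)
    neumann_left := fun t ht => H.neumann_left t (h2 ht)
    neumann_right := fun t ht => H.neumann_right t (h2 ht)
    evolution := fun t ht => H.evolution t (h2 ht)
    avg := fun t ht => H.avg t (h2 ht) }

/-- On a compact time interval the solution stays in a box. -/
lemma exists_isBoxed {ρ q p m ρt qt : ℝ → ℝ → ℝ} {h : ℝ → ℝ}
    (H : IsRadialFlow n a b T ρ q p m ρt qt h) (hab : a < b) {τ : ℝ} (hτ : τ ∈ Ico 0 T) :
    ∃ δ R M : ℝ, 0 < δ ∧ ∀ t ∈ Icc 0 τ, IsBoxed a b δ R M (ρ t) (q t) := by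
  have hsub : Icc 0 τ ⊆ Ico 0 T := fun t ht => ⟨ht.1, ht.2.trans_lt hτ.2⟩
  have hK : IsCompact (Icc 0 τ ×ˢ Icc a b) := isCompact_Icc.prod isCompact_Icc
  have c1 := H.cont.mono (prod_mono hsub (subset_refl (Icc a b)))
  have c2 := H.cont_q.mono (prod_mono hsub (subset_refl (Icc a b)))
  obtain ⟨R, hR⟩ := hK.exists_bound_of_continuousOn c1
  obtain ⟨M, hM⟩ := hK.exists_bound_of_continuousOn c2
  obtain ⟨z, hz, hmin⟩ := hK.exists_isMinOn ⟨(0, a), ⟨le_rfl, hτ.1⟩, ⟨le_rfl, hab.le⟩⟩ c1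
  refine ⟨ρ z.1 z.2, R, M, H.pos _ (hsub hz.1) _ hz.2, fun t ht =>
    ⟨H.continuousOn_ρ (hsub ht), H.continuousOn_q (hsub ht), fun s hs => ⟨?_, ?_⟩,
      fun s hs => ?_⟩⟩
  · exact hmin (⟨ht, hs⟩ : (t, s) ∈ Icc 0 τ ×ˢ Icc a b)
  · exact (le_abs_self _).trans (hR (t, s) ⟨ht, hs⟩)
  · exact abs_le.1 (hM (t, s) ⟨ht, hs⟩)

/-- The principal part is `∂ₛ arctan q`, so it can be integrated by parts; the Neumann conditions
remove the boundary terms. -/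
lemma integral_mul_sub_arctan (H₁ : IsRadialFlow n a b T ρ₁ q₁ p₁ m₁ ρt₁ qt₁ h₁)
    (H₂ : IsRadialFlow n a b T ρ₂ q₂ p₂ m₂ ρt₂ qt₂ h₂) (hab : a < b) {t : ℝ} (ht : t ∈ Ioo 0 T) :
    ∫ s in a..b, (ρ₁ t s - ρ₂ t s) * (p₁ t s / (1 + q₁ t s ^ 2) - p₂ t s / (1 + q₂ t s ^ 2)) =
      -∫ s in a..b, (q₁ t s - q₂ t s) * (Real.arctan (q₁ t s) - Real.arctan (q₂ t s)) := by
  have ht' : t ∈ Ico 0 T := ⟨ht.1.le, ht.2⟩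
  have c1 := H₁.continuousOn_ρ ht'
  have c2 := H₂.continuousOn_ρ ht'
  have c3 := H₁.continuousOn_q ht'
  have c4 := H₂.continuousOn_q ht'
  have c5 := H₁.continuousOn_p ht
  have c6 := H₂.continuousOn_p ht
  have n1 : ∀ s ∈ Icc a b, 1 + q₁ t s ^ 2 ≠ 0 := fun s _ => by positivity
  have n2 : ∀ s ∈ Icc a b, 1 + q₂ t s ^ 2 ≠ 0 := fun s _ => by positivity
  have c7 : ContinuousOn (fun s => Real.arctan (q₁ t s)) (Icc a b) :=
    Real.continuous_arctan.comp_continuousOn c3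
  have c8 : ContinuousOn (fun s => Real.arctan (q₂ t s)) (Icc a b) :=
    Real.continuous_arctan.comp_continuousOn c4
  have := integral_eq_sub_of_hasDerivWithinAt_Icc hab
    (f := fun s => (ρ₁ t s - ρ₂ t s) * (Real.arctan (q₁ t s) - Real.arctan (q₂ t s)))
    (f' := fun s => (q₁ t s - q₂ t s) * (Real.arctan (q₁ t s) - Real.arctan (q₂ t s)) +
      (ρ₁ t s - ρ₂ t s) * (p₁ t s / (1 + q₁ t s ^ 2) - p₂ t s / (1 + q₂ t s ^ 2)))
    (fun s hs => by
      refine (((H₁.space t ht s hs).sub (H₂.space t ht s hs)).mul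
        ((H₁.space_q t ht s hs).arctan.sub (H₂.space_q t ht s hs).arctan)).congr_deriv ?_
      simp only [Pi.sub_apply]
      ring) (by fun_prop (disch := assumption))
  rw [intervalIntegral.integral_add, H₁.neumann_left t ht, H₁.neumann_right t ht,
    H₂.neumann_left t ht, H₂.neumann_right t ht] at this
  · simp only [sub_self, mul_zero] at this
    linarith
  all_goals refine ContinuousOn.intervalIntegrable_of_Icc hab.le ?_
  all_goals fun_prop (disch := assumption)

/-- The energy estimate for the difference of two solutions. -/
lemma exists_energy_estimate (hn : 1 ≤ n) (hab : a < b) {δ : ℝ} (hδ : 0 < δ) (R M : ℝ) :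
    ∃ K : ℝ, ∀ {T : ℝ} {ρ₁ q₁ p₁ m₁ ρt₁ qt₁ : ℝ → ℝ → ℝ} {h₁ : ℝ → ℝ}
      {ρ₂ q₂ p₂ m₂ ρt₂ qt₂ : ℝ → ℝ → ℝ} {h₂ : ℝ → ℝ},
      IsRadialFlow n a b T ρ₁ q₁ p₁ m₁ ρt₁ qt₁ h₁ → IsRadialFlow n a b T ρ₂ q₂ p₂ m₂ ρt₂ qt₂ h₂ →
      ∀ t ∈ Ioo 0 T, IsBoxed a b δ R M (ρ₁ t) (q₁ t) → IsBoxed a b δ R M (ρ₂ t) (q₂ t) →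
      ∫ s in a..b, (ρ₁ t s - ρ₂ t s) * (ρt₁ t s - ρt₂ t s) ≤
        K * ∫ s in a..b, (ρ₁ t s - ρ₂ t s) ^ 2 := by
  obtain ⟨L, B, hL, hB, hbd, hlip⟩ := exists_avg_lipschitz n hab hδ R M
  set c := (1 + M ^ 2)⁻¹ with hc
  have hcpos : 0 < c := by positivity
  set W := √(1 + M ^ 2) * L with hW
  have hWnn : 0 ≤ W := by positivity
  have hn' : (1 : ℝ) ≤ n := by exact_mod_cast hn
  set l := b - a with hl
  have hlpos : 0 < l := by linarith
  -- The first summand comes from `(n - 1) / ρ`, the second from `h₁` times the difference of the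
  -- `√(1 + q²)`, the last two from `h₁ - h₂`.
  refine ⟨((n : ℝ) - 1) / δ ^ 2 + B ^ 2 / (2 * c) + W * l + W ^ 2 * l ^ 2 / (2 * c), ?_⟩
  intro T ρ₁ q₁ p₁ m₁ ρt₁ qt₁ h₁ ρ₂ q₂ p₂ m₂ ρt₂ qt₂ h₂ H₁ H₂ t ht b₁ b₂
  have ht' : t ∈ Ico 0 T := ⟨ht.1.le, ht.2⟩
  have c1 := b₁.cont
  have c2 := b₂.cont
  have c3 := b₁.cont_slope
  have c4 := b₂.cont_slope
  have c5 := H₁.continuousOn_p ht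
  have c6 := H₂.continuousOn_p ht
  have c9 := H₁.continuousOn_ρt ht
  have c10 := H₂.continuousOn_ρt ht
  have n1 : ∀ s ∈ Icc a b, 1 + q₁ t s ^ 2 ≠ 0 := fun s _ => by positivity
  have n2 : ∀ s ∈ Icc a b, 1 + q₂ t s ^ 2 ≠ 0 := fun s _ => by positivity
  have n3 : ∀ s ∈ Icc a b, ρ₁ t s ≠ 0 := fun s hs => (H₁.pos t ht' s hs).ne'
  have n4 : ∀ s ∈ Icc a b, ρ₂ t s ≠ 0 := fun s hs => (H₂.pos t ht' s hs).ne'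
  have c7 : ContinuousOn (fun s => Real.arctan (q₁ t s)) (Icc a b) :=
    Real.continuous_arctan.comp_continuousOn c3
  have c8 : ContinuousOn (fun s => Real.arctan (q₂ t s)) (Icc a b) :=
    Real.continuous_arctan.comp_continuousOn c4
  have hb1 := hbd _ _ b₁
  have hl12 := hlip _ _ _ _ b₁ b₂
  rw [← H₁.avg_eq hn hab ht] at hb1
  rw [← H₁.avg_eq hn hab ht, ← H₂.avg_eq hn hab ht, intervalIntegral.integral_add
    (ContinuousOn.intervalIntegrable_of_Icc hab.le (by fun_prop))
    (ContinuousOn.intervalIntegrable_of_Icc hab.le (by fun_prop))] at hl12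
  have hX2 := sq_integral_abs_le hab (c1.sub c2)
  have hY2 := sq_integral_abs_le hab (c3.sub c4)
  simp only [Pi.sub_apply, ← hl] at hX2 hY2
  have e1 : ∫ s in a..b, (ρ₁ t s - ρ₂ t s) * (ρt₁ t s - ρt₂ t s) =
      (∫ s in a..b, (ρ₁ t s - ρ₂ t s) *
        (p₁ t s / (1 + q₁ t s ^ 2) - p₂ t s / (1 + q₂ t s ^ 2))) +
      ∫ s in a..b, (ρ₁ t s - ρ₂ t s) * (-(((n : ℝ) - 1) / ρ₁ t s - ((n : ℝ) - 1) / ρ₂ t s) +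
        (h₁ t * √(1 + q₁ t s ^ 2) - h₂ t * √(1 + q₂ t s ^ 2))) := by
    rw [← intervalIntegral.integral_add]
    · refine intervalIntegral.integral_congr fun s hs => ?_
      rw [uIcc_of_le hab.le] at hs
      rw [H₁.evolution' ht hs, H₂.evolution' ht hs]
      ring
    all_goals refine ContinuousOn.intervalIntegrable_of_Icc hab.le ?_
    all_goals fun_prop (disch := assumption)
  have e2 : c * (∫ s in a..b, (q₁ t s - q₂ t s) ^ 2) ≤
      ∫ s in a..b, (q₁ t s - q₂ t s) * (Real.arctan (q₁ t s) - Real.arctan (q₂ t s)) := by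
    rw [← intervalIntegral.integral_const_mul]
    refine intervalIntegral.integral_mono_on hab.le
      (ContinuousOn.intervalIntegrable_of_Icc hab.le (by fun_prop))
      (ContinuousOn.intervalIntegrable_of_Icc hab.le (by fun_prop)) fun s hs => ?_
    exact mul_sub_arctan_ge (b₁.mem_slope s hs) (b₂.mem_slope s hs)
  have e3 : ∫ s in a..b, (ρ₁ t s - ρ₂ t s) * (-(((n : ℝ) - 1) / ρ₁ t s - ((n : ℝ) - 1) / ρ₂ t s) +
        (h₁ t * √(1 + q₁ t s ^ 2) - h₂ t * √(1 + q₂ t s ^ 2))) ≤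
      (((n : ℝ) - 1) / δ ^ 2 + B ^ 2 / (2 * c)) * (∫ s in a..b, (ρ₁ t s - ρ₂ t s) ^ 2) +
      c / 2 * (∫ s in a..b, (q₁ t s - q₂ t s) ^ 2) +
      W * ((∫ s in a..b, |ρ₁ t s - ρ₂ t s|) + ∫ s in a..b, |q₁ t s - q₂ t s|) *
        ∫ s in a..b, |ρ₁ t s - ρ₂ t s| := by
    rw [← intervalIntegral.integral_const_mul, ← intervalIntegral.integral_const_mul,
      ← intervalIntegral.integral_const_mul, ← intervalIntegral.integral_add,
      ← intervalIntegral.integral_add]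
    · refine intervalIntegral.integral_mono_on hab.le
        (ContinuousOn.intervalIntegrable_of_Icc hab.le (by fun_prop (disch := assumption)))
        (ContinuousOn.intervalIntegrable_of_Icc hab.le (by fun_prop)) fun s hs => ?_
      have r1 := (b₁.mem s hs).1
      have r2 := (b₂.mem s hs).1
      have p1 := hδ.trans_le r1
      have p2 := hδ.trans_le r2
      have s1 := abs_sqrt_sub_sqrt_le (q₁ t s) (q₂ t s)
      have s2 : √(1 + q₂ t s ^ 2) ≤ √(1 + M ^ 2) := by
        have := (b₂.mem_slope s hs)
        refine Real.sqrt_le_sqrt ?_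
        have := sq_le_sq' this.1 this.2
        linarith
      have t1 : (ρ₁ t s - ρ₂ t s) * -(((n : ℝ) - 1) / ρ₁ t s - ((n : ℝ) - 1) / ρ₂ t s) ≤
          ((n : ℝ) - 1) / δ ^ 2 * (ρ₁ t s - ρ₂ t s) ^ 2 := by
        have e : (ρ₁ t s - ρ₂ t s) * -(((n : ℝ) - 1) / ρ₁ t s - ((n : ℝ) - 1) / ρ₂ t s) =
            ((n : ℝ) - 1) / (ρ₁ t s * ρ₂ t s) * (ρ₁ t s - ρ₂ t s) ^ 2 := by
          field_simp
          ring
        rw [e]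
        refine mul_le_mul_of_nonneg_right ?_ (sq_nonneg _)
        refine div_le_div_of_nonneg_left (by linarith) (by positivity) ?_
        rw [sq]
        exact mul_le_mul r1 r2 hδ.le p1.le
      have t2 : (ρ₁ t s - ρ₂ t s) * (h₁ t * √(1 + q₁ t s ^ 2) - h₂ t * √(1 + q₂ t s ^ 2)) ≤
          |ρ₁ t s - ρ₂ t s| * (B * |q₁ t s - q₂ t s| + W * ((∫ s in a..b, |ρ₁ t s - ρ₂ t s|) +
            ∫ s in a..b, |q₁ t s - q₂ t s|)) := by
        refine (le_abs_self _).trans ?_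
        rw [abs_mul]
        refine mul_le_mul_of_nonneg_left ?_ (abs_nonneg _)
        have e : h₁ t * √(1 + q₁ t s ^ 2) - h₂ t * √(1 + q₂ t s ^ 2) =
            h₁ t * (√(1 + q₁ t s ^ 2) - √(1 + q₂ t s ^ 2)) +
              √(1 + q₂ t s ^ 2) * (h₁ t - h₂ t) := by ring
        rw [e]
        refine (abs_add_le _ _).trans ?_
        rw [abs_mul, abs_mul, abs_of_pos (sqrt_pos _), hW, mul_assoc (√(1 + M ^ 2))]
        exact add_le_add (mul_le_mul hb1 s1 (abs_nonneg _) hB)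
          (mul_le_mul s2 hl12 (abs_nonneg _) (by positivity))
      have t3 : |ρ₁ t s - ρ₂ t s| * (B * |q₁ t s - q₂ t s|) ≤
          B ^ 2 / (2 * c) * (ρ₁ t s - ρ₂ t s) ^ 2 + c / 2 * (q₁ t s - q₂ t s) ^ 2 := by
        rw [← sq_abs (ρ₁ t s - ρ₂ t s), ← sq_abs (q₁ t s - q₂ t s)]
        have e : B ^ 2 / (2 * c) * |ρ₁ t s - ρ₂ t s| ^ 2 + c / 2 * |q₁ t s - q₂ t s| ^ 2 -
            |ρ₁ t s - ρ₂ t s| * (B * |q₁ t s - q₂ t s|) =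
            (B * |ρ₁ t s - ρ₂ t s| - c * |q₁ t s - q₂ t s|) ^ 2 / (2 * c) := by
          field_simp
          ring
        have : 0 ≤ (B * |ρ₁ t s - ρ₂ t s| - c * |q₁ t s - q₂ t s|) ^ 2 / (2 * c) := by positivity
        linarith
      linarith
    all_goals refine ContinuousOn.intervalIntegrable_of_Icc hab.le ?_
    all_goals fun_prop
  rw [e1, H₁.integral_mul_sub_arctan H₂ hab ht]
  generalize (∫ s in a..b, |ρ₁ t s - ρ₂ t s|) = X at *
  generalize (∫ s in a..b, |q₁ t s - q₂ t s|) = Y at *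
  generalize (∫ s in a..b, (ρ₁ t s - ρ₂ t s) ^ 2) = E at *
  generalize (∫ s in a..b, (q₁ t s - q₂ t s) ^ 2) = D at *
  have f1 : W * X ^ 2 ≤ W * (l * E) := mul_le_mul_of_nonneg_left hX2 hWnn
  -- Young's inequality, weighted to cost `c / 2 * D`; the pointwise estimate cost the other half,
  -- and together they use up the `c * D` gained from monotonicity of `arctan`.
  have f2 : W * Y * X ≤ c / (2 * l) * Y ^ 2 + W ^ 2 * l / (2 * c) * X ^ 2 := by
    have e : c / (2 * l) * Y ^ 2 + W ^ 2 * l / (2 * c) * X ^ 2 - W * Y * X =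
        (c * Y - W * l * X) ^ 2 / (2 * c * l) := by
      field_simp
      ring
    have : 0 ≤ (c * Y - W * l * X) ^ 2 / (2 * c * l) := by positivity
    linarith
  have f3 : c / (2 * l) * Y ^ 2 ≤ c / 2 * D := by
    refine (mul_le_mul_of_nonneg_left hY2 (by positivity)).trans (le_of_eq ?_)
    field_simp
  have f4 : W ^ 2 * l / (2 * c) * X ^ 2 ≤ W ^ 2 * l ^ 2 / (2 * c) * E := by
    refine (mul_le_mul_of_nonneg_left hX2 (by positivity)).trans (le_of_eq ?_)
    field_simp
  have f5 : W * (X + Y) * X = W * X ^ 2 + W * Y * X := by ring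
  rw [f5] at e3
  linarith

/-- Two solutions with the same initial values coincide. -/
theorem eq_of_eq_zero (H₁ : IsRadialFlow n a b T ρ₁ q₁ p₁ m₁ ρt₁ qt₁ h₁)
    (H₂ : IsRadialFlow n a b T ρ₂ q₂ p₂ m₂ ρt₂ qt₂ h₂) (hn : 1 ≤ n) (hab : a < b)
    (h0 : ∀ s ∈ Icc a b, ρ₁ 0 s = ρ₂ 0 s) {t s : ℝ} (ht : t ∈ Ico 0 T) (hs : s ∈ Icc a b) :
    ρ₁ t s = ρ₂ t s := by
  obtain ⟨δ₁, R₁, M₁, hδ₁, hbox₁⟩ := H₁.exists_isBoxed hab ht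
  obtain ⟨δ₂, R₂, M₂, hδ₂, hbox₂⟩ := H₂.exists_isBoxed hab ht
  obtain ⟨K, hK⟩ := exists_energy_estimate hn hab (lt_min hδ₁ hδ₂) (max R₁ R₂) (max M₁ M₂)
  have hb₁ : ∀ τ ∈ Icc 0 t, IsBoxed a b (min δ₁ δ₂) (max R₁ R₂) (max M₁ M₂) (ρ₁ τ) (q₁ τ) :=
    fun τ hτ => ⟨(hbox₁ τ hτ).cont, (hbox₁ τ hτ).cont_slope,
      fun s hs => Icc_subset_Icc (min_le_left _ _) (le_max_left _ _) ((hbox₁ τ hτ).mem s hs),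
      fun s hs => Icc_subset_Icc (neg_le_neg (le_max_left _ _)) (le_max_left _ _)
        ((hbox₁ τ hτ).mem_slope s hs)⟩
  have hb₂ : ∀ τ ∈ Icc 0 t, IsBoxed a b (min δ₁ δ₂) (max R₁ R₂) (max M₁ M₂) (ρ₂ τ) (q₂ τ) :=
    fun τ hτ => ⟨(hbox₂ τ hτ).cont, (hbox₂ τ hτ).cont_slope,
      fun s hs => Icc_subset_Icc (min_le_right _ _) (le_max_right _ _) ((hbox₂ τ hτ).mem s hs),
      fun s hs => Icc_subset_Icc (neg_le_neg (le_max_right _ _)) (le_max_right _ _)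
        ((hbox₂ τ hτ).mem_slope s hs)⟩
  set E : ℝ → ℝ := fun τ => ∫ s in a..b, (ρ₁ τ s - ρ₂ τ s) ^ 2 with hE
  have hEc : ContinuousOn E (Ico 0 T) :=
    continuousOn_intervalIntegral hab (f := fun τ s => (ρ₁ τ s - ρ₂ τ s) ^ 2)
      ((H₁.cont.sub H₂.cont).pow 2)
  have hsub : Ioo 0 T ×ˢ Icc a b ⊆ Ico 0 T ×ˢ Icc a b := prod_mono Ioo_subset_Ico_self subset_rfl
  have hEd : ∀ τ ∈ Ioo 0 T,
      HasDerivAt E (2 * ∫ s in a..b, (ρ₁ τ s - ρ₂ τ s) * (ρt₁ τ s - ρt₂ τ s)) τ := fun τ hτ => by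
    rw [← intervalIntegral.integral_const_mul]
    refine hasDerivAt_intervalIntegral (f := fun τ s => (ρ₁ τ s - ρ₂ τ s) ^ 2)
      (ft := fun τ s => 2 * ((ρ₁ τ s - ρ₂ τ s) * (ρt₁ τ s - ρt₂ τ s))) hab (fun τ hτ => ?_)
      (((H₁.cont.mono hsub).sub (H₂.cont.mono hsub)).mul (H₁.cont_ρt.sub H₂.cont_ρt)
        |>.const_smul (2 : ℝ)) (fun τ hτ s hs => ?_) hτ
    · have := H₁.continuousOn_ρ (t := τ) ⟨hτ.1.le, hτ.2⟩
      have := H₂.continuousOn_ρ (t := τ) ⟨hτ.1.le, hτ.2⟩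
      fun_prop
    · refine (((H₁.time τ hτ s hs).sub (H₂.time τ hτ s hs)).pow 2).congr_deriv ?_
      simp
      ring
  -- Grönwall's argument for `E' ≤ 2 K E` with `E 0 = 0`.
  have hanti : AntitoneOn (fun τ => Real.exp (-(2 * K) * τ) * E τ) (Icc 0 t) := by
    have hint : interior (Icc 0 t) ⊆ Ioo 0 T := by
      rw [interior_Icc]; exact Ioo_subset_Ioo_right ht.2.le
    have hd : ∀ τ ∈ Ioo 0 T, HasDerivAt (fun τ => Real.exp (-(2 * K) * τ) * E τ)
        (Real.exp (-(2 * K) * τ) * (2 * ((∫ s in a..b, (ρ₁ τ s - ρ₂ τ s) * (ρt₁ τ s - ρt₂ τ s)) -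
          K * E τ))) τ := fun τ hτ => by
      refine ((((hasDerivAt_id τ).const_mul (-(2 * K))).exp).mul (hEd τ hτ)).congr_deriv ?_
      simp
      ring
    refine antitoneOn_of_deriv_nonpos (convex_Icc 0 t) ?_
      (fun τ hτ => (hd τ (hint hτ)).differentiableAt.differentiableWithinAt) fun τ hτ => ?_
    · have := hEc.mono (fun τ (hτ : τ ∈ Icc 0 t) => (⟨hτ.1, hτ.2.trans_lt ht.2⟩ : τ ∈ Ico 0 T))
      fun_prop
    · rw [(hd τ (hint hτ)).deriv]
      have hτ' := interior_subset hτ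
      have := hK H₁ H₂ τ (hint hτ) (hb₁ τ hτ') (hb₂ τ hτ')
      exact mul_nonpos_of_nonneg_of_nonpos (Real.exp_pos _).le (by linarith)
  have hE0 : E 0 = 0 := by
    have : E 0 = ∫ _ in a..b, (0 : ℝ) := by
      refine intervalIntegral.integral_congr fun s hs => ?_
      rw [uIcc_of_le hab.le] at hs
      simp [h0 s hs]
    simpa using this
  have hEt : E t ≤ 0 := by
    have := hanti ⟨le_rfl, ht.1⟩ ⟨ht.1, le_rfl⟩ ht.1
    simp only [hE0, mul_zero] at this
    exact nonpos_of_mul_nonpos_right this (Real.exp_pos _)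
  by_contra hne
  have := intervalIntegral.integral_pos (f := fun s => (ρ₁ t s - ρ₂ t s) ^ 2) hab
    (((H₁.continuousOn_ρ ht).sub (H₂.continuousOn_ρ ht)).pow 2) (fun _ _ => sq_nonneg _)
    ⟨s, hs, by have := sub_ne_zero.2 hne; positivity⟩
  exact absurd this (not_lt.2 hEt)

end IsRadialFlow

end Uniqueness

/-! ### Back to the geometric flow. -/

/-- Two flows from the same hypersurface coincide as long as both exist. -/
theorem Flow.radius_eq {n : ℕ} (hn : 1 ≤ n) {a b T₁ T₂ : ℝ} (hab : a < b) {ρ₀ : ℝ → ℝ}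
    (F₁ : Flow n a b ρ₀ T₁) (F₂ : Flow n a b ρ₀ T₂) {t s : ℝ} (h0 : 0 ≤ t) (h1 : t < T₁)
    (h2 : t < T₂) (hs : s ∈ Icc a b) : F₁.radius t s = F₂.radius t s := by
  obtain ⟨p₁, m₁, ρt₁, qt₁, h₁, H₁⟩ := F₁.exists_isRadialFlow hn hab
  obtain ⟨p₂, m₂, ρt₂, qt₂, h₂, H₂⟩ := F₂.exists_isRadialFlow hn hab
  exact (H₁.mono (min_le_left T₁ T₂)).eq_of_eq_zero (H₂.mono (min_le_right T₁ T₂)) hn hab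
    (fun s hs => (F₁.radius_zero s hs).trans (F₂.radius_zero s hs).symm)
    ⟨h0, lt_min h1 h2⟩ hs

lemma Flow.surface_eq {n : ℕ} (hn : 1 ≤ n) {a b T₁ T₂ : ℝ} (hab : a < b) {ρ₀ : ℝ → ℝ}
    (F₁ : Flow n a b ρ₀ T₁) (F₂ : Flow n a b ρ₀ T₂) {t : ℝ} (h0 : 0 ≤ t) (h1 : t < T₁)
    (h2 : t < T₂) : F₁.surface t = F₂.surface t := by
  ext x
  refine and_congr_right fun hx => ?_
  rw [F₁.radius_eq hn hab F₂ h0 h1 h2 hx]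

/-- The singular time is determined by the initial hypersurface. -/
lemma Flow.singular_time_le {n : ℕ} (hn : 1 ≤ n) {a b T₁ T₂ : ℝ} (hab : a < b) {ρ₀ : ℝ → ℝ}
    (F₁ : Flow n a b ρ₀ T₁) (F₂ : Flow n a b ρ₀ T₂) (hs : F₁.IsSingularAtEnd) : T₂ ≤ T₁ := by
  by_contra! hlt
  exact hs ⟨T₂, hlt, F₂, fun t ht => F₂.surface_eq hn hab F₁ ht.1 (ht.2.trans hlt) ht.2⟩

/-- The product of the gradient function and the height function in terms of the radius. -/
lemma Flow.gradFun_mul_height {n : ℕ} {a b T : ℝ} (hab : a < b) {ρ₀ : ℝ → ℝ}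
    (hρ₀ : IsInitialRadius a b ρ₀) (F : Flow n a b ρ₀ T) {t : ℝ} (ht : t ∈ Ico 0 T) {x : Amb n}
    (hx : x ∈ F.surface t) : gradFun a b (F.radius t) x * height x =
      √(1 + derivWithin (F.radius t) (Icc a b) (x 0) ^ 2) * F.radius t (x 0) := by
  have hpos := F.radius_pos t ht _ hx.1
  -- At `t = 0` differentiability comes from `ρ₀`, since the flow is smooth only for positive times.
  have hd : DifferentiableWithinAt ℝ (F.radius t) (Icc a b) (x 0) := by
    rcases ht.1.eq_or_lt with h | h
    · rw [← h]
      exact (hρ₀.smooth.differentiableOn (by simp) _ hx.1).congr F.radius_zero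
        (F.radius_zero _ hx.1)
    · exact (hasDerivWithinAt_stripDeriv F.radius_smooth ⟨h, ht.2⟩ hx.1).differentiableWithinAt
  rw [gradFun_eq hab hx.1 (norm_ne_zero_iff.1 (hx.2.trans_ne hpos.ne')) hd.hasDerivWithinAt,
    height_eq, hx.2]

end AxialFlow

theorem lemma5p2 (n : ℕ) (hn : 1 ≤ n) (a b : ℝ) (hab : a < b) (ρ₀ : ℝ → ℝ)
    (hρ₀ : AxialFlow.IsInitialRadius a b ρ₀) :
    ∃ c₄ : ℝ, ∀ (T : ℝ) (F : AxialFlow.Flow n a b ρ₀ T), 0 < T → F.IsSingularAtEnd →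
      ∀ t ∈ Set.Ico 0 T, ∀ x ∈ F.surface t,
        AxialFlow.gradFun a b (F.radius t) x * AxialFlow.height x < c₄ := by
  -- The bound of one fixed singular flow serves for all, as each coincides with it and lives no
  -- longer. Without singular flows any constant works.
  by_cases hex : ∃ (T : ℝ) (F : AxialFlow.Flow n a b ρ₀ T), 0 < T ∧ F.IsSingularAtEnd
  · obtain ⟨T₀, F₀, hT₀, hs₀⟩ := hex
    obtain ⟨p, m, ρt, qt, h, H⟩ := F₀.exists_isRadialFlow hn hab
    obtain ⟨C, hC⟩ := H.exists_gradient_height_bound hn hab hT₀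
    refine ⟨C, fun T F _ _ t ht x hx => ?_⟩
    have htT₀ : t < T₀ := ht.2.trans_le (F₀.singular_time_le hn hab F hs₀)
    have hr : ∀ s ∈ Set.Icc a b, F.radius t s = F₀.radius t s := fun s hs =>
      F.radius_eq hn hab F₀ ht.1 ht.2 htT₀ hs
    rw [F.gradFun_mul_height hab hρ₀ ht hx, derivWithin_congr hr (hr _ hx.1), hr _ hx.1]
    exact hC t ⟨ht.1, htT₀⟩ _ hx.1
  · exact ⟨0, fun T F hT hs => absurd ⟨T, F, hT, hs⟩ hex⟩
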